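/- Conventions. A (monoid) generating set of a group $G$ is a set $X$ with a surjective monoid homomorphism $\pi\colon X^*\to G$. For $C\le G$, a positive cone relative to $C$ is a subsemigroup $P\subseteq G$ with $G=P\sqcup C\sqcup P^{-1}$; a left-order $\prec$ on $G$ is a total order invariant under left multiplication, with positive cone $P_\prec=\{g: 1\prec g\}$. For a class $\mathcal C$ of languages, $\prec$ is a $\mathcal C$-left-order with respect to a finite generating set $(X,\pi)$ if $\pi(\mathcal L)=P_\prec$ for some language $\mathcal L\subseteq X^*$ in $\mathcal C$. A language is one-counter if it is accepted (by final state) by a nondeterministic pushdown automaton whose stack alphabet has exactly one letter (moves depend on whether the stack is empty). An ordering quasi-morphism with kernel $C$ is a map $\tau\colon G\to\mathbb Z$ such that $|\tau(g)+\tau(h)-\tau(gh)|$ is bounded, $\{g:\tau(g)=0\}=C$ is a subgroup, $\tau(g)=-\tau(g^{-1})$, and $\tau(g)+\tau(h)+\tau((gh)^{-1})\le 1$ for all $g,h\in G$. A rational transducer $\mathbb T$ is a nondeterministic finite automaton (with $\epsilon$-moves) that writes a word on each move; $\mathbb T(w)$ is the set of outputs of accepting runs on $w$, and $\mathbb T^{-1}(\mathcal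 L)=\{w:\mathbb T(w)\cap\mathcal L\ne\emptyset\}$. Given a finite generating set $(X,\pi)$ of $G$, a $\tau$-transducer is a rational transducer with input alphabet $X$ and output alphabet $\{t,t^{-1}\}$ such that the words $w$ with $\mathbb T(w)\neq\emptyset$ represent all elements of $G$, and every $v\in\mathbb T(w)$ satisfies $\sharp_t(v)-\sharp_{t^{-1}}(v)=\tau(\pi(w))$. Put $\mathcal L_{>0}=\{v\in\{t,t^{-1}\}^*:\sharp_t(v)>\sharp_{t^{-1}}(v)\}$. (1) Let $I$ be a finite set, let $G_i$ ($i\in I$) be groups with finite generating sets $(X_i,\pi_i)$ and with a common subgroup $C$ with finite generating set $(Y,\pi_C)$, and let $G$ be the free product of the $G_i$ amalgamated over $C$, with the generating set $X=Y\sqcup\bigsqcup_i X_i$ and the induced evaluation $\pi$. For each $i$ let $P_i$ be a positive cone of $G_i$ relative to $C$, and let $\mathcal L_i\subseteq X_i^*$ be a regular language with $\pi_i(\mathcal L_i)=P_i$. Then there is an ordering quasi-morphism $\tau\colon G\to (2\mathbb Z+1)\cup\{0\}$ with kernel $C$, there are regular languages $\mathcal L_i^-\subseteq X_i^*$ with $\pi_i(\mathcal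 L_i^-)=P_i^{-1}$, and there is a $\tau$-transducer $\mathbb T$ such that $\pi(\mathbb T^{-1}(\mathcal L_{>0}))$ is a positive cone of $G$ relative to $C$ and $$\mathbb T^{-1}(\mathcal L_{>0})=\{w=w_1\cdots w_m z : m\ge 0,\ w_j\in\mathcal L_{i_j}\cup\mathcal L_{i_j}^-,\ i_j\in I,\ i_j\ne i_{j+1},\ z\in Y^*,\ \tau(\pi(w))>0\}.$$ (2) Let $A$ and $B$ be groups that admit regular left-orders with respect to finite generating sets $X$ and $Y$. Then there is an ordering quasi-morphism $\tau\colon A*B\to(2\mathbb Z+1)\cup\{0\}$ with trivial kernel, and a $\tau$-transducer $\mathbb T$ over the generating set $X\sqcup Y$ of $A*B$, such that the language $\mathbb T^{-1}(\mathcal L_{>0})$ is one-counter and evaluates onto $\{g:\tau(g)>0\}$. Moreover $\{g:\tau(g)>0\}$ is the positive cone of a left-order on $A*B$, which is a one-counter left-order with respect to every finite generating set of $A*B$. In particular $A*B$ admits a one-counter left-order. -/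

import Mathlib

namespace LeftOrderLang

/-! ### Pushdown automata and one-counter languages -/

/-- A nondeterministic pushdown automaton with states `S`, input alphabet `X` and stack alphabet
`Γ`. `none : Option X` is the empty input, `none : Option Γ` stands for the empty stack. The top of
the stack is the last letter of the stack word. -/
structure PDA (S X Γ : Type*) where
  step : S → Option X → Option Γ → Finset (S × List Γ)
  start : S
  initStack : List Γ
  accept : Set S

namespace PDA

variable {S X Γ : Type*} (M : PDA S X Γ)

/-- One move with input `x`: the last stack letter `σ` (if the stack is non-empty) is deleted, and a
word `u` allowed by the transition function on `σ` is appended. On the empty stack the move is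
governed by the value of the transition function at `none`. -/
def Move (x : Option X) (c c' : S × List Γ) : Prop :=
  ∃ u : List Γ, (c'.1, u) ∈ M.step c.1 x c.2.getLast? ∧ c'.2 = c.2.dropLast ++ u

/-- `M.Run c w c'`: there is a sequence of moves from the configuration `c` to `c'` that reads the
word `w`; moves with empty input may occur anywhere. -/
inductive Run : S × List Γ → List X → S × List Γ → Prop
  | refl (c : S × List Γ) : Run c [] c
  | move {c c' c'' : S × List Γ} {x : Option X} {w : List X} :
      M.Move x c c' → Run c' w c'' → Run c (x.toList ++ w) c''

/-- The language accepted by final state. -/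
def accepts : Language X :=
  {w | ∃ c : S × List Γ, c.1 ∈ M.accept ∧ M.Run (M.start, M.initStack) w c}

end PDA

/-- A language is one-counter if it is accepted by a pushdown automaton with finitely many states
and a stack alphabet with exactly one letter. -/
def IsOneCounter {X : Type*} (L : Language X) : Prop :=
  ∃ (S Γ : Type) (_ : Finite S) (_ : Nat.card Γ = 1) (M : PDA S X Γ), M.accepts = L

/-! ### Rational transducers -/

/-- A transducer with states `S`, input alphabet `X` and output alphabet `Y`; `none : Option X` is
the empty input. -/
structure Transducer (S X Y : Type*) where
  step : S → Option X → Finset (S × List Y)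
  start : S
  accept : Set S

namespace Transducer

variable {S X Y : Type*} (T : Transducer S X Y)

/-- `T.Run s w s' v`: the transducer can go from `s` to `s'` reading `w` and writing `v`. -/
inductive Run : S → List X → S → List Y → Prop
  | refl (s : S) : Run s [] s []
  | move {s s' s'' : S} {x : Option X} {w : List X} {u v : List Y} :
      (s', u) ∈ T.step s x → Run s' w s'' v → Run s (x.toList ++ w) s'' (u ++ v)

/-- The set `T(w)` of outputs on the input word `w`. -/
def outputs (w : List X) : Language Y :=
  {v | ∃ s ∈ T.accept, T.Run T.start w s v}

/-- The inverse image of a language under `T`. -/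
def preimage (L : Language Y) : Language X :=
  {w | ∃ v ∈ L, v ∈ T.outputs w}

end Transducer

/-! ### Generating sets, positive cones and left-orders -/

variable {G : Type*} [Group G] {X : Type*}

/-- The monoid homomorphism from words over `X` to `G` determined by its values on letters. -/
def eval (p : X → G) (w : List X) : G := (w.map p).prod

/-- `(X, p)` is a monoid generating set of `G`. -/
def IsGenerating (p : X → G) : Prop := Function.Surjective (eval p)

/-- `P` is a subsemigroup of `G`, and `G` is the disjoint union of `P`, `C` and `P⁻¹`. -/
structure IsRelPositiveCone (C : Subgroup G) (P : Set G) : Prop where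
  mul_mem : ∀ g ∈ P, ∀ h ∈ P, g * h ∈ P
  cover : ∀ g, g ∈ P ∨ g ∈ C ∨ g⁻¹ ∈ P
  disjoint_left : ∀ g ∈ P, g ∉ C
  disjoint_inv : ∀ g ∈ P, g⁻¹ ∉ P

/-- `lt` is (the strict part of) a left-order: a strict total order that is invariant under left
multiplication. -/
structure IsLeftOrder (lt : G → G → Prop) : Prop where
  irrefl : ∀ a, ¬ lt a a
  trans : ∀ a b c, lt a b → lt b c → lt a c
  total : ∀ a b, lt a b ∨ a = b ∨ lt b a
  mul_left : ∀ a b c, lt a b ↔ lt (c * a) (c * b)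

/-- The positive cone of a left-order. -/
def positiveCone (lt : G → G → Prop) : Set G := {g | lt 1 g}

/-- `lt` is a `𝒞`-left-order with respect to the generating set `(X, p)`: its positive cone is the
evaluation of a language over `X` in the class `𝒞`. -/
def IsLeftOrderOfClass (𝒞 : Language X → Prop) (p : X → G) (lt : G → G → Prop) : Prop :=
  IsLeftOrder lt ∧ ∃ L : Language X, 𝒞 L ∧ eval p '' {w | w ∈ L} = positiveCone lt

/-! ### Ordering quasi-morphisms and their transducers -/

/-- `τ` is an ordering quasi-morphism with kernel `C`. -/
structure IsOrderingQuasimorphism (τ : G → ℤ) (C : Subgroup G) : Prop where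
  quasi : ∃ D : ℤ, ∀ g h, |τ g + τ h - τ (g * h)| ≤ D
  kernel : ∀ g, τ g = 0 ↔ g ∈ C
  inv : ∀ g, τ g = -τ g⁻¹
  le_one : ∀ g h, τ g + τ h + τ (g * h)⁻¹ ≤ 1

/-- The evaluation of words over `{t, t⁻¹}` in `ℤ`; `t` is `true` and `t⁻¹` is `false`. -/
def evalInt (v : List Bool) : ℤ := (v.map fun b => if b then (1 : ℤ) else -1).sum

/-- The words over `{t, t⁻¹}` in which `t` occurs more often than `t⁻¹`. -/
def posWords : Language Bool := {v | v.count false < v.count true}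

/-- `T` is a `τ`-transducer with respect to the generating set `(X, p)`: the words on which `T` has
an output represent all elements of `G`, and every output of `T` on `w` evaluates to the value of
`τ` at the element represented by `w`. -/
structure IsTauTransducer {S : Type*} (T : Transducer S X Bool) (p : X → G) (τ : G → ℤ) :
    Prop where
  surj : ∀ g, ∃ w, (∃ v, v ∈ T.outputs w) ∧ eval p w = g
  compute : ∀ w v, v ∈ T.outputs w → τ (eval p w) = evalInt v

/-! ### Generating sets and words of free products -/

/-- The generating set `Y ⊔ ⨆ X i` of the amalgamated free product of the `G i` over `H`. -/
def amalgamGens {ι H Y : Type*} {G X : ι → Type*} [∀ i, Group (G i)] [Group H]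
    (φ : ∀ i, H →* G i) (p : ∀ i, X i → G i) (q : Y → H) :
    Y ⊕ (Σ i, X i) → Monoid.PushoutI φ :=
  Sum.elim (fun y => Monoid.PushoutI.base φ (q y)) (fun x => Monoid.PushoutI.of x.1 (p x.1 x.2))

/-- The generating set `X ⊔ Y` of the free product of `A` and `B`. -/
def coprodGens {A B X Y : Type*} [Group A] [Group B] (p : X → A) (q : Y → B) :
    X ⊕ Y → Monoid.Coprod A B :=
  Sum.elim (fun x => Monoid.Coprod.inl (p x)) (fun y => Monoid.Coprod.inr (q y))

/-- The words `w₁ ⋯ wₘ z` where `wⱼ` is a word over `X iⱼ` in `Lp iⱼ ∪ Lm iⱼ`, consecutive indices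
`iⱼ` are distinct, and `z` is any word over `Y`. -/
def syllableWords {ι Y : Type*} {X : ι → Type*} (Lp Lm : ∀ i, Language (X i)) :
    Language (Y ⊕ (Σ i, X i)) :=
  {w | ∃ (l : List (Σ i, List (X i))) (z : List Y),
    l.IsChain (fun a b => a.1 ≠ b.1) ∧ (∀ a ∈ l, a.2 ∈ Lp a.1 ∨ a.2 ∈ Lm a.1) ∧
    w = (l.flatMap fun a => a.2.map fun x => Sum.inr ⟨a.1, x⟩) ++ z.map Sum.inl}

end LeftOrderLang

open LeftOrderLang

/-!
Every `g` outside `C` has a reduced expression whose syllables lie in the `G i` and outside `C`.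
Let `τ g` be the sum of the signs of its syllables with respect to the cones `P i`, plus one jump
`±1` for every two consecutive syllables, positive if the index increases and negative if it
decreases. The signs do not change under multiplication with `C`, and the sum is odd, having an odd
number of terms `±1`. In a quotient `g⁻¹ * h` everything cancels except around one place, where at
most two syllables merge into one; comparing the few signs and jumps there gives defect at most `1`.
By parity, this bound also shows that the sum does not depend on the reduced expression and that
`τ g⁻¹ = -τ g`.

A finite transducer that reads a word syllable by syllable can write the signs and the jumps, since
it has to remember only the index and the sign of the last syllable, and one counter suffices to
check that the sum of what it writes is positive.
-/

namespace LeftOrderLang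

namespace Transducer

variable {S X Y Z Q : Type*} {T : Transducer S X Y}

theorem Run.trans {s s' s'' : S} {w w' : List X} {v v' : List Y} (h : T.Run s w s' v)
    (h' : T.Run s' w' s'' v') : T.Run s (w ++ w') s'' (v ++ v') := by
  induction h with
  | refl => exact h'
  | move hm _ ih => simpa only [List.append_assoc] using Run.move hm (ih h')

theorem Run.single {s s' : S} {x : Option X} {v : List Y} (h : (s', v) ∈ T.step s x) :
    T.Run s x.toList s' v := by
  simpa only [List.append_nil] using Run.move h (.refl s')

/-! ### Restricting the states of a transducer -/

/-- The transducer `T` restricted to the states in the range of `f`. -/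
noncomputable def restrict (T : Transducer S X Y) {f : Q → S} (hf : Function.Injective f)
    (start : Q) : Transducer Q X Y where
  step q x := (T.step (f q) x).preimage (Prod.map f id) (hf.prodMap Function.injective_id).injOn
  start := start
  accept := f ⁻¹' T.accept

variable {f : Q → S} {hf : Function.Injective f} {q₀ : Q}

theorem mem_step_restrict {q : Q} {x : Option X} {m : Q × List Y} :
    m ∈ (T.restrict hf q₀).step q x ↔ (f m.1, m.2) ∈ T.step (f q) x :=
  Finset.mem_preimage (hf := (hf.prodMap Function.injective_id).injOn)

theorem Run.of_restrict {q q' : Q} {w : List X} {v : List Y}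
    (h : (T.restrict hf q₀).Run q w q' v) : T.Run (f q) w (f q') v := by
  induction h with
  | refl => exact .refl _
  | move hm _ ih => exact .move (mem_step_restrict.1 hm) ih

theorem Run.exists_restrict (hstep : ∀ q x, ∀ m ∈ T.step (f q) x, m.1 ∈ Set.range f)
    {s s' : S} {w : List X} {v : List Y} (h : T.Run s w s' v) {q : Q} (hq : f q = s) :
    ∃ q', f q' = s' ∧ (T.restrict hf q₀).Run q w q' v := by
  induction h generalizing q with
  | refl => exact ⟨q, hq, .refl q⟩
  | move hm _ ih =>
    subst hq
    obtain ⟨r, rfl⟩ := hstep _ _ _ hm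
    obtain ⟨q', hq', hr⟩ := ih rfl
    exact ⟨q', hq', .move (mem_step_restrict.2 hm) hr⟩

theorem outputs_restrict (hstart : f q₀ = T.start)
    (hstep : ∀ q x, ∀ m ∈ T.step (f q) x, m.1 ∈ Set.range f) :
    (T.restrict hf q₀).outputs = T.outputs := by
  ext w v
  constructor
  · rintro ⟨q, hq, h⟩
    exact ⟨f q, hq, hstart ▸ h.of_restrict⟩
  · rintro ⟨s, hs, h⟩
    obtain ⟨q, rfl, hr⟩ := h.exists_restrict hstep hstart
    exact ⟨q, hs, hr⟩

theorem exists_outputs_eq_of_finite (T : Transducer S X Y) {A : Set S} (hA : A.Finite)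
    (hstart : T.start ∈ A) (hstep : ∀ s ∈ A, ∀ x, ∀ m ∈ T.step s x, m.1 ∈ A) :
    ∃ (Q : Type) (_ : Finite Q) (T' : Transducer Q X Y), T'.outputs = T.outputs ∧
      ∀ q x, ∀ m ∈ T'.step q x, ∃ s, ∃ m' ∈ T.step s x, m'.2 = m.2 := by
  have := hA.to_subtype
  obtain ⟨n, ⟨e⟩⟩ := Finite.exists_equiv_fin A
  have hf : Function.Injective fun k => (e.symm k : S) :=
    Subtype.val_injective.comp e.symm.injective
  refine ⟨Fin n, inferInstance, T.restrict hf (e ⟨T.start, hstart⟩),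
    outputs_restrict (by simp) fun k x m hm => ?_,
    fun k x m hm => ⟨_, _, mem_step_restrict.1 hm, rfl⟩⟩
  exact ⟨e ⟨m.1, hstep _ (e.symm k).2 x m hm⟩, by simp⟩

/-! ### Substituting words for the input letters -/

open Classical in
/-- The transducer that reads `w.flatMap h` where `T` reads `w`, one letter at a time: a state
consists of a state of `T` and of the words that remain to be read and to be written before the
next move of `T`. -/
noncomputable def substInput [Fintype X] (T : Transducer S X Y) (h : X → List Z) :
    Transducer (S × List Z × List Y) Z Y where
  step
    | (s, a :: u, v), some b => if b = a then {((s, u, v), [])} else ∅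
    | (s, [], a :: v), none => {((s, [], v), [a])}
    | (s, [], []), none => Finset.univ.biUnion fun x =>
        (T.step s x).image fun m => ((m.1, x.toList.flatMap h, m.2), [])
    | _, _ => ∅
  start := (T.start, [], [])
  accept := {q | q.1 ∈ T.accept ∧ q.2 = ([], [])}

theorem finite_setOf_suffix {α : Type*} (l : List α) : {u | u <:+ l}.Finite := by
  simpa only [List.mem_tails] using l.tails.finite_toSet

/-- The states of `T.substInput h` that can occur in a run from the start. -/
def substInputStates (T : Transducer S X Y) (h : X → List Z) : Set (S × List Z × List Y) :=
  {q | (∃ x : Option X, q.2.1 <:+ x.toList.flatMap h) ∧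
    (q.2.2 = [] ∨ ∃ s x, ∃ m ∈ T.step s x, q.2.2 <:+ m.2)}

theorem finite_substInputStates [Finite S] [Finite X] (T : Transducer S X Y) (h : X → List Z) :
    (T.substInputStates h).Finite := by
  have hread : {u | ∃ x : Option X, u <:+ x.toList.flatMap h}.Finite := by
    simpa only [Set.ofPred_exists] using Set.finite_iUnion fun x => finite_setOf_suffix _
  have hwrite : {v | ∃ s x, ∃ m ∈ T.step s x, v <:+ m.2}.Finite := by
    simp only [Set.ofPred_exists]
    refine Set.finite_iUnion fun s => Set.finite_iUnion fun x => ?_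
    simp only [← exists_prop, Set.ofPred_exists]
    exact (T.step s x).finite_toSet.biUnion fun m _ => finite_setOf_suffix m.2
  exact (Set.finite_univ.prod (hread.prod ((Set.finite_singleton []).union hwrite))).subset
    fun q hq => ⟨trivial, hq⟩

section

variable [Fintype X] {h : X → List Z}

theorem substInput_run_read (s : S) (u : List Z) (v : List Y) :
    (T.substInput h).Run (s, u, v) u (s, [], v) [] := by
  induction u with
  | nil => exact .refl _
  | cons a u ih => exact .move (x := some a) (u := []) (by simp [substInput]) ih

theorem substInput_run_write (s : S) (v : List Y) :
    (T.substInput h).Run (s, [], v) [] (s, [], []) v := by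
  induction v with
  | nil => exact .refl _
  | cons a v ih => exact .move (x := none) (u := [a]) (by simp [substInput]) ih

theorem Run.substInput {s s' : S} {w : List X} {v : List Y} (hr : T.Run s w s' v) :
    (T.substInput h).Run (s, [], []) (w.flatMap h) (s', [], []) v := by
  induction hr with
  | refl => exact .refl _
  | @move s s' _ x w u v hm _ ih =>
    have hload : (T.substInput h).Run (s, [], []) [] (s', x.toList.flatMap h, u) [] :=
      Run.single (x := none) <| by
        simpa [Transducer.substInput] using ⟨x, hm, rfl⟩
    simpa using hload.trans
      ((substInput_run_read _ _ _).trans ((substInput_run_write _ _).trans ih))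

theorem load_or_step_of_mem_step_substInput {q : S × List Z × List Y} {x : Option Z}
    {m : (S × List Z × List Y) × List Y} (hm : m ∈ (T.substInput h).step q x) :
    (q.2 = ([], []) ∧ x = none ∧ m.2 = [] ∧
      ∃ y : Option X, m.1.2.1 = y.toList.flatMap h ∧ (m.1.1, m.1.2.2) ∈ T.step q.1 y) ∨
    (m.1.1 = q.1 ∧ q.2.1 = x.toList ++ m.1.2.1 ∧ q.2.2 = m.2 ++ m.1.2.2) := by
  rcases q with ⟨s, _ | ⟨a, u⟩, _ | ⟨b, v⟩⟩ <;> rcases x with _ | c <;>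
    simp only [substInput, Finset.notMem_empty, Finset.mem_biUnion, Finset.mem_univ,
      Finset.mem_image, true_and, Finset.mem_singleton] at hm
  · obtain ⟨x, m, hm, rfl⟩ := hm
    exact Or.inl ⟨rfl, rfl, rfl, x, rfl, hm⟩
  · simp [hm]
  all_goals
    split_ifs at hm with hc
    · simp [Finset.mem_singleton.1 hm, hc]
    · simp at hm

theorem Run.of_substInput {q q' : S × List Z × List Y} {w : List Z} {v : List Y}
    (hr : (T.substInput h).Run q w q' v) (hq' : q'.2 = ([], [])) :
    ∃ w' v', w = q.2.1 ++ w'.flatMap h ∧ v = q.2.2 ++ v' ∧ T.Run q.1 w' q'.1 v' := by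
  induction hr with
  | refl => exact ⟨[], [], by simp [hq'], by simp [hq'], .refl _⟩
  | move hm _ ih =>
    obtain ⟨w', v', rfl, rfl, hr⟩ := ih hq'
    rcases load_or_step_of_mem_step_substInput hm with ⟨hq, rfl, hu, y, hy, hm⟩ | ⟨hs, hw, hv⟩
    · exact ⟨y.toList ++ w', _, by simp_all, by simp_all, .move hm hr⟩
    · exact ⟨w', v', by simp_all, by simp_all, hs ▸ hr⟩

theorem mem_outputs_substInput {w : List Z} {v : List Y} :
    v ∈ (T.substInput h).outputs w ↔ ∃ w', w'.flatMap h = w ∧ v ∈ T.outputs w' := by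
  constructor
  · rintro ⟨q, ⟨hq, hq'⟩, hr⟩
    obtain ⟨w', v', rfl, rfl, hr⟩ := hr.of_substInput hq'
    exact ⟨w', rfl, q.1, hq, hr⟩
  · rintro ⟨w', rfl, s, hs, hr⟩
    exact ⟨_, ⟨hs, rfl⟩, hr.substInput⟩

theorem length_le_one_of_mem_step_substInput {q : S × List Z × List Y} {x : Option Z}
    {m : (S × List Z × List Y) × List Y} (hm : m ∈ (T.substInput h).step q x) :
    m.2.length ≤ 1 := by
  rcases q with ⟨s, _ | ⟨a, u⟩, _ | ⟨b, v⟩⟩ <;> rcases x with _ | c <;>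
    grind [substInput]

theorem mem_substInputStates_of_mem_step {q : S × List Z × List Y}
    (hq : q ∈ T.substInputStates h) {x : Option Z} {m : (S × List Z × List Y) × List Y}
    (hm : m ∈ (T.substInput h).step q x) : m.1 ∈ T.substInputStates h := by
  rcases load_or_step_of_mem_step_substInput hm with ⟨-, -, -, y, hy, hm⟩ | ⟨-, hu, hv⟩
  · exact ⟨⟨y, hy ▸ List.suffix_rfl⟩, Or.inr ⟨_, y, _, hm, List.suffix_rfl⟩⟩
  · obtain ⟨⟨y, hy⟩, hq⟩ := hq
    refine ⟨⟨y, (List.suffix_append _ _).trans (hu ▸ hy)⟩, ?_⟩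
    rcases hq with hq | ⟨s, z, m', hm', hq⟩
    · exact Or.inl (List.append_eq_nil_iff.1 (hv ▸ hq)).2
    · exact Or.inr ⟨s, z, m', hm', (List.suffix_append _ _).trans (hv ▸ hq)⟩

end

theorem exists_outputs_flatMap [Finite S] [Finite X] (T : Transducer S X Y) (h : X → List Z) :
    ∃ (Q : Type) (_ : Finite Q) (T' : Transducer Q Z Y),
      (∀ w v, v ∈ T'.outputs w ↔ ∃ w', w'.flatMap h = w ∧ v ∈ T.outputs w') ∧
      ∀ q z, ∀ m ∈ T'.step q z, m.2.length ≤ 1 := by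
  have := Fintype.ofFinite X
  obtain ⟨Q, hQ, T', hT', hlen⟩ := (T.substInput h).exists_outputs_eq_of_finite
    (finite_substInputStates T h) ⟨⟨none, List.nil_suffix⟩, Or.inl rfl⟩
    fun q hq x m hm => mem_substInputStates_of_mem_step hq hm
  refine ⟨Q, hQ, T', fun w v => hT' ▸ mem_outputs_substInput, fun q z m hm => ?_⟩
  obtain ⟨s, m', hm', h⟩ := hlen q z m hm
  exact h ▸ length_le_one_of_mem_step_substInput hm'

section

variable {S X X' Y : Type*}

/-- The transducer that makes the moves of `T` for the letter `f x` on the letter `x`. -/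
def comap (T : Transducer S X Y) (f : X' → X) : Transducer S X' Y where
  step s x := T.step s (x.map f)
  start := T.start
  accept := T.accept

theorem Run.of_comap {T : Transducer S X Y} {f : X' → X} {s s' : S} {w : List X'} {v : List Y}
    (h : (T.comap f).Run s w s' v) : T.Run s (w.map f) s' v := by
  induction h with
  | refl => exact .refl _
  | @move _ _ _ x _ _ _ hm _ ih =>
    rw [List.map_append, ← Option.toList_map]
    exact .move hm ih

theorem Run.comap {T : Transducer S X Y} {f : X' → X} {s s' : S} {w : List X} {v : List Y}
    (h : T.Run s w s' v) {w' : List X'} (hw : w'.map f = w) : (T.comap f).Run s w' s' v := by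
  induction h generalizing w' with
  | refl =>
    obtain rfl := List.map_eq_nil_iff.1 hw
    exact .refl _
  | @move _ _ _ x _ _ _ hm _ ih =>
    obtain ⟨w₁, w₂, rfl, hw₁, hw₂⟩ := List.map_eq_append_iff.1 hw
    obtain ⟨y, rfl, rfl⟩ : ∃ y : Option X', y.map f = x ∧ y.toList = w₁ := by
      cases x with
      | none => exact ⟨none, rfl, (List.map_eq_nil_iff.1 hw₁).symm⟩
      | some x =>
        obtain ⟨y, rfl, rfl⟩ := List.map_eq_singleton_iff.1 hw₁
        exact ⟨some y, rfl, rfl⟩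
    exact .move (T := T.comap f) hm (ih hw₂)

theorem outputs_comap (T : Transducer S X Y) (f : X' → X) (w : List X') :
    (T.comap f).outputs w = T.outputs (w.map f) := by
  ext v
  constructor <;> rintro ⟨s, hs, h⟩
  · exact ⟨s, hs, h.of_comap⟩
  · exact ⟨s, hs, h.comap rfl⟩

end

/-! ### Domains of transducers and regular languages -/

section

variable {S X Y : Type*}

/-- The automaton with `ε`-moves that forgets the output of `T`. -/
def toεNFA (T : Transducer S X Y) : εNFA X S where
  step s x := {s' | ∃ v, (s', v) ∈ T.step s x}
  start := {T.start}
  accept := T.accept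

theorem exists_run_iff_exists_isPath {T : Transducer S X Y} {s s' : S} {w : List X} :
    (∃ v, T.Run s w s' v) ↔ ∃ l : List (Option X), l.reduceOption = w ∧
      T.toεNFA.IsPath s s' l := by
  constructor
  · rintro ⟨v, h⟩
    induction h with
    | refl => exact ⟨[], rfl, .nil _⟩
    | @move _ _ _ x _ u _ hm _ ih =>
      obtain ⟨l, rfl, hl⟩ := ih
      exact ⟨x :: l, by cases x <;> simp, .cons _ _ _ _ _ ⟨u, hm⟩ hl⟩
  · rintro ⟨l, rfl, h⟩
    induction h with
    | nil => exact ⟨[], .refl _⟩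
    | cons _ _ _ x l hm _ ih =>
      obtain ⟨v, hv⟩ := ih
      obtain ⟨u, hu⟩ := hm
      have hl : (x :: l).reduceOption = x.toList ++ l.reduceOption := by cases x <;> simp
      exact ⟨u ++ v, hl ▸ .move hu hv⟩

theorem isRegular_domain [Finite S] (T : Transducer S X Y) :
    Language.IsRegular ({w | ∃ v, v ∈ T.outputs w} : Language X) := by
  classical
  have := Fintype.ofFinite S
  refine Language.isRegular_iff.2 ⟨Set S, inferInstance, T.toεNFA.toNFA.toDFA, ?_⟩
  rw [NFA.toDFA_correct, εNFA.toNFA_correct]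
  ext w
  rw [εNFA.mem_accepts_iff_exists_path]
  constructor
  · rintro ⟨s, s', l, rfl, hs', hl, h⟩
    obtain ⟨v, hv⟩ := exists_run_iff_exists_isPath.2 ⟨l, hl, h⟩
    exact ⟨v, s', hs', hv⟩
  · rintro ⟨v, s', hs', h⟩
    obtain ⟨l, hl, h⟩ := exists_run_iff_exists_isPath.1 ⟨v, h⟩
    exact ⟨_, s', l, rfl, hs', hl, h⟩

/-- A deterministic automaton as a transducer that writes the empty word. -/
def ofDFA (M : DFA X S) : Transducer S X Empty where
  step s x := x.elim ∅ fun x => {(M.step s x, [])}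
  start := M.start
  accept := M.accept

theorem exists_run_ofDFA_iff {M : DFA X S} {s s' : S} {w : List X} :
    (∃ v, (ofDFA M).Run s w s' v) ↔ M.evalFrom s w = s' := by
  constructor
  · rintro ⟨v, h⟩
    induction h with
    | refl => rfl
    | @move _ _ _ x _ _ _ hm _ ih =>
      rcases x with _ | x
      · simp [ofDFA] at hm
      · obtain ⟨rfl, rfl⟩ := Prod.mk.inj (Finset.mem_singleton.1 hm)
        exact ih
  · rintro rfl
    induction w generalizing s with
    | nil => exact ⟨[], .refl _⟩
    | cons x w ih =>
      obtain ⟨v, hv⟩ := ih (s := M.step s x)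
      exact ⟨v, .move (x := some x) (u := []) (Finset.mem_singleton_self _) hv⟩

theorem exists_mem_outputs_ofDFA_iff {M : DFA X S} {w : List X} :
    (∃ v, v ∈ (ofDFA M).outputs w) ↔ w ∈ M.accepts := by
  constructor
  · rintro ⟨v, s, hs, h⟩
    rwa [← exists_run_ofDFA_iff.1 ⟨v, h⟩] at hs
  · intro h
    obtain ⟨v, hv⟩ := exists_run_ofDFA_iff.2 (rfl : M.evalFrom M.start w = _)
    exact ⟨v, _, h, hv⟩

end

end Transducer

theorem isRegular_image_flatMap {X Z : Type*} [Finite X] {L : Language X} (hL : L.IsRegular)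
    (h : X → List Z) :
    Language.IsRegular ({w | ∃ w' ∈ L, w'.flatMap h = w} : Language Z) := by
  obtain ⟨σ, _, M, rfl⟩ := hL
  obtain ⟨Q, _, T, hT, -⟩ := (Transducer.ofDFA M).exists_outputs_flatMap h
  have hdomain : ({w | ∃ w' ∈ M.accepts, w'.flatMap h = w} : Language Z) =
      {w | ∃ v, v ∈ T.outputs w} := by
    ext w
    simp only [hT, ← Transducer.exists_mem_outputs_ofDFA_iff]
    exact ⟨fun ⟨w', ⟨v, hv⟩, hw⟩ => ⟨v, w', hw, hv⟩, fun ⟨v, w', hw, hv⟩ => ⟨w', ⟨v, hv⟩, hw⟩⟩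
  exact hdomain ▸ T.isRegular_domain

section

variable {G X Z : Type*} [Group G]

theorem eval_cons (p : X → G) (x : X) (w : List X) : eval p (x :: w) = p x * eval p w := by
  simp [eval]

theorem eval_append (p : X → G) (u v : List X) : eval p (u ++ v) = eval p u * eval p v := by
  simp [eval]

theorem eval_flatMap (p : X → G) (r : Z → G) {h : X → List Z}
    (hh : ∀ x, eval r (h x) = p x) (w : List X) : eval r (w.flatMap h) = eval p w := by
  induction w with
  | nil => rfl
  | cons x w ih => rw [List.flatMap_cons, eval_append, hh, ih, eval_cons]

theorem eval_inv (p : X → G) (w : List X) : eval p⁻¹ w = (eval p w.reverse)⁻¹ := by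
  simp only [eval, List.prod_inv_reverse, List.map_reverse, List.map_map, List.reverse_reverse]
  rfl

theorem exists_isRegular_image_eval_eq_inv [Finite X] {p : X → G} (hp : IsGenerating p)
    {L : Language X} (hL : L.IsRegular) :
    ∃ L' : Language X, L'.IsRegular ∧
      eval p '' {w | w ∈ L'} = {g | g⁻¹ ∈ eval p '' {w | w ∈ L}} := by
  choose c hc using fun x => hp (p x)⁻¹
  refine ⟨_, isRegular_image_flatMap hL.reverse c, ?_⟩
  have hc' (w : List X) : eval p (w.flatMap c) = eval p⁻¹ w := eval_flatMap _ p hc w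
  ext g
  constructor
  · rintro ⟨_, ⟨w, hw, rfl⟩, rfl⟩
    exact ⟨w.reverse, hw, by rw [hc', eval_inv, inv_inv]⟩
  · rintro ⟨w, hw, hg⟩
    exact ⟨_, ⟨w.reverse, Language.reverse_mem_reverse.2 hw, rfl⟩,
      by rw [hc', eval_inv, List.reverse_reverse, hg, inv_inv]⟩

end

/-! ### Counting -/

theorem evalInt_nil : evalInt [] = 0 := rfl

theorem evalInt_cons (b : Bool) (v : List Bool) :
    evalInt (b :: v) = (if b then 1 else -1) + evalInt v := by
  simp [evalInt]

theorem evalInt_append (u v : List Bool) : evalInt (u ++ v) = evalInt u + evalInt v := by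
  simp [evalInt]

theorem evalInt_eq_count_sub_count (v : List Bool) :
    evalInt v = v.count true - v.count false := by
  induction v with
  | nil => rfl
  | cons b v ih => cases b <;> simp [evalInt_cons, ih] <;> ring

theorem mem_posWords_iff {v : List Bool} : v ∈ posWords ↔ 0 < evalInt v := by
  rw [evalInt_eq_count_sub_count, sub_pos, Nat.cast_lt]
  rfl

/-- The integer stored in a one-counter automaton: the state remembers the sign `b`, the stack word
`γ` has the absolute value as its length. -/
def counterValue (b : Bool) (γ : List Unit) : ℤ := if b then γ.length else -γ.length

/-- The effect on a counter of sign `b` with top letter `σ` of adding the value of a word of length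
at most one: the new sign and the word that replaces the top letter. -/
def counterUpdate (b : Bool) (σ : Option Unit) : List Bool → Bool × List Unit
  | [] => (b, σ.toList)
  | c :: _ => if c = b then (b, σ.toList ++ [()]) else if σ = none then (c, [()]) else (b, [])

theorem counterValue_counterUpdate (b : Bool) (γ : List Unit) {u : List Bool}
    (hu : u.length ≤ 1) :
    counterValue (counterUpdate b γ.getLast? u).1
      (γ.dropLast ++ (counterUpdate b γ.getLast? u).2) = counterValue b γ + evalInt u := by
  rcases List.eq_nil_or_concat γ with rfl | ⟨γ, a, rfl⟩ <;>
  match u, hu with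
  | [], _ => cases b <;> simp [counterUpdate, counterValue, evalInt_nil]
  | [c], _ =>
    cases b <;> cases c <;> simp [counterUpdate, counterValue, evalInt] <;> ring

theorem counterValue_pos_iff {b : Bool} {γ : List Unit} :
    0 < counterValue b γ ↔ b = true ∧ γ ≠ [] := by
  cases b <;> simp [counterValue, List.length_pos_iff]

section

variable {S X : Type*}

open Classical in
/-- The pushdown automaton that follows `T`, keeping the value of the output in its counter, and
that can enter its accepting state `none` when `T` accepts and the counter is positive. -/
noncomputable def counterPDA (T : Transducer S X Bool) : PDA (Option (S × Bool)) X Unit where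
  step q x σ := q.elim ∅ fun p =>
    ((T.step p.1 x).image fun m =>
      (some (m.1, (counterUpdate p.2 σ m.2).1), (counterUpdate p.2 σ m.2).2)) ∪
    if x = none ∧ σ ≠ none ∧ p.2 = true ∧ p.1 ∈ T.accept then {(none, [])} else ∅
  start := some (T.start, true)
  initStack := []
  accept := {none}

variable {T : Transducer S X Bool} {s s' : S} {b : Bool} {γ : List Unit} {x : Option X}
  {w : List X}

theorem not_counterPDA_move_none {c : Option (S × Bool) × List Unit} :
    ¬ (counterPDA T).Move x (none, γ) c := by
  simp [PDA.Move, counterPDA]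

theorem counterPDA_move_iff {c : Option (S × Bool) × List Unit} :
    (counterPDA T).Move x (some (s, b), γ) c ↔
      (∃ s' u, (s', u) ∈ T.step s x ∧ c = (some (s', (counterUpdate b γ.getLast? u).1),
        γ.dropLast ++ (counterUpdate b γ.getLast? u).2)) ∨
      (x = none ∧ 0 < counterValue b γ ∧ s ∈ T.accept ∧ c = (none, γ.dropLast)) := by
  obtain ⟨q, δ⟩ := c
  simp only [PDA.Move, counterPDA, Option.elim_some, Finset.mem_union, Finset.mem_image,
    counterValue_pos_iff]
  constructor
  · rintro ⟨u, ⟨⟨s', v⟩, hm, h⟩ | h, hδ⟩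
    · obtain ⟨rfl, rfl⟩ := Prod.mk.inj h
      exact Or.inl ⟨s', v, hm, Prod.ext rfl hδ⟩
    · grind
  · rintro (⟨s', v, hm, h⟩ | ⟨rfl, ⟨rfl, hγ⟩, hs, h⟩) <;> obtain ⟨rfl, rfl⟩ := Prod.mk.inj h
    · exact ⟨_, Or.inl ⟨_, hm, rfl⟩, rfl⟩
    · exact ⟨[], Or.inr (by simp [hγ, hs]), by simp⟩

theorem exists_counterPDA_run_of_run (hT : ∀ s x, ∀ m ∈ T.step s x, m.2.length ≤ 1)
    {v : List Bool} (h : T.Run s w s' v) (hs' : s' ∈ T.accept)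
    (hpos : 0 < counterValue b γ + evalInt v) :
    ∃ δ, (counterPDA T).Run (some (s, b), γ) w (none, δ) := by
  induction h generalizing b γ with
  | refl s =>
    rw [evalInt_nil, add_zero] at hpos
    exact ⟨_, .move (x := none) (counterPDA_move_iff.2 (Or.inr ⟨rfl, hpos, hs', rfl⟩)) (.refl _)⟩
  | @move _ _ _ _ _ u _ hm _ ih =>
    have hvalue := counterValue_counterUpdate b γ (hT _ _ _ hm)
    obtain ⟨δ, hδ⟩ := ih hs' (by rw [hvalue]; rwa [evalInt_append, ← add_assoc] at hpos)
    exact ⟨δ, .move (counterPDA_move_iff.2 (Or.inl ⟨_, u, hm, rfl⟩)) hδ⟩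

theorem exists_run_of_counterPDA_run (hT : ∀ s x, ∀ m ∈ T.step s x, m.2.length ≤ 1)
    {δ : List Unit} (h : (counterPDA T).Run (some (s, b), γ) w (none, δ)) :
    ∃ s' ∈ T.accept, ∃ v, T.Run s w s' v ∧ 0 < counterValue b γ + evalInt v := by
  generalize hc : ((some (s, b), γ) : Option (S × Bool) × List Unit) = c at h
  generalize hd : ((none, δ) : Option (S × Bool) × List Unit) = d at h
  induction h generalizing s b γ with
  | refl => simp [← hd] at hc
  | move hm hr ih =>
    subst hc
    rcases counterPDA_move_iff.1 hm with ⟨s', u, hu, rfl⟩ | ⟨rfl, hpos, hs, rfl⟩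
    · obtain ⟨s'', hs'', v, hv, hpos⟩ := ih rfl hd
      rw [counterValue_counterUpdate b γ (hT _ _ _ hu), add_assoc, ← evalInt_append] at hpos
      exact ⟨s'', hs'', u ++ v, .move hu hv, hpos⟩
    · cases hr with
      | refl => exact ⟨s, hs, [], .refl s, by rwa [evalInt_nil, add_zero]⟩
      | move hm _ => exact absurd hm not_counterPDA_move_none

theorem accepts_counterPDA (hT : ∀ s x, ∀ m ∈ T.step s x, m.2.length ≤ 1) :
    (counterPDA T).accepts = T.preimage posWords := by
  ext w
  constructor
  · rintro ⟨⟨_, δ⟩, rfl, h⟩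
    obtain ⟨s, hs, v, hr, hpos⟩ := exists_run_of_counterPDA_run hT h
    exact ⟨v, mem_posWords_iff.2 (by simpa [counterPDA, counterValue] using hpos), s, hs, hr⟩
  · rintro ⟨v, hv, s, hs, hr⟩
    obtain ⟨δ, h⟩ := exists_counterPDA_run_of_run hT hr hs (b := true) (γ := [])
      (by simpa [counterValue] using mem_posWords_iff.1 hv)
    exact ⟨(none, δ), rfl, h⟩

theorem isOneCounter_image_flatMap_preimage_posWords {Z : Type*} [Finite S] [Finite X]
    (T : Transducer S X Bool) (h : X → List Z) :
    IsOneCounter ({w | ∃ w' ∈ T.preimage posWords, w'.flatMap h = w} : Language Z) := by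
  obtain ⟨Q, _, T', hT', hlen⟩ := T.exists_outputs_flatMap h
  refine ⟨Option (Q × Bool), Unit, inferInstance, by simp, counterPDA T', ?_⟩
  rw [accepts_counterPDA hlen]
  ext w
  constructor
  · rintro ⟨v, hv, hw⟩
    obtain ⟨w', hw', hv'⟩ := (hT' w v).1 hw
    exact ⟨w', ⟨v, hv, hv'⟩, hw'⟩
  · rintro ⟨w', ⟨v, hv, hv'⟩, hw'⟩
    exact ⟨v, hv, (hT' w v).2 ⟨w', hw', hv'⟩⟩

theorem isOneCounter_preimage_posWords [Finite S] [Finite X] (T : Transducer S X Bool) :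
    IsOneCounter (T.preimage posWords) := by
  have h : ({w | ∃ w' ∈ T.preimage posWords, w'.flatMap (fun x => [x]) = w} : Language X) =
      T.preimage posWords := by
    ext w
    exact ⟨fun ⟨w', h, hw⟩ => (List.flatMap_singleton' w' ▸ hw) ▸ h,
      fun h => ⟨w, h, List.flatMap_singleton' w⟩⟩
  exact h ▸ isOneCounter_image_flatMap_preimage_posWords T fun x => [x]

end

/-! ### Signs and jumps -/

section Sign

variable {G : Type*} [Group G]

open Classical in
/-- The sign of `g` with respect to a relative positive cone `P`. -/
noncomputable def coneSign (P : Set G) (g : G) : ℤ :=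
  if g ∈ P then 1 else if g⁻¹ ∈ P then -1 else 0

variable {C : Subgroup G} {P : Set G}

theorem coneSign_of_mem {g : G} (hg : g ∈ P) : coneSign P g = 1 := if_pos hg

theorem abs_coneSign_le_one (g : G) : |coneSign P g| ≤ 1 := by
  unfold coneSign
  split_ifs <;> simp

namespace IsRelPositiveCone

variable (hP : IsRelPositiveCone C P) {g c : G}
include hP

theorem coneSign_inv (g : G) : coneSign P g⁻¹ = -coneSign P g := by
  have := hP.disjoint_inv g
  simp only [coneSign, inv_inv]
  split_ifs <;> simp_all

theorem coneSign_of_inv_mem (hg : g⁻¹ ∈ P) : coneSign P g = -1 := by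
  rw [← coneSign_of_mem hg, hP.coneSign_inv, neg_neg]

theorem coneSign_of_mem_subgroup (hg : g ∈ C) : coneSign P g = 0 := by
  have h : ∀ x ∈ C, x ∉ P := fun x hx hxP => hP.disjoint_left x hxP hx
  rw [coneSign, if_neg (h g hg), if_neg (h _ (C.inv_mem hg))]

theorem odd_coneSign (hg : g ∉ C) : Odd (coneSign P g) := by
  rcases hP.cover g with h | h | h
  · simp [coneSign_of_mem h]
  · exact absurd h hg
  · simp [hP.coneSign_of_inv_mem h]

theorem mul_mem_of_mem_left (hc : c ∈ C) (hg : g ∈ P) : c * g ∈ P := by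
  rcases hP.cover (c * g) with h | h | h
  · exact h
  · exact absurd ((C.mul_mem_cancel_left hc).1 h) (hP.disjoint_left g hg)
  · have hcP : c⁻¹ ∈ P := by simpa using hP.mul_mem _ hg _ h
    exact absurd (C.inv_mem hc) (hP.disjoint_left _ hcP)

theorem mul_mem_of_mem_right (hg : g ∈ P) (hc : c ∈ C) : g * c ∈ P := by
  rcases hP.cover (g * c) with h | h | h
  · exact h
  · exact absurd ((C.mul_mem_cancel_right hc).1 h) (hP.disjoint_left g hg)
  · have hcP : c⁻¹ ∈ P := by simpa using hP.mul_mem _ h _ hg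
    exact absurd (C.inv_mem hc) (hP.disjoint_left _ hcP)

theorem coneSign_mul_left (hc : c ∈ C) (g : G) : coneSign P (c * g) = coneSign P g := by
  rcases hP.cover g with hg | hg | hg
  · rw [coneSign_of_mem hg, coneSign_of_mem (hP.mul_mem_of_mem_left hc hg)]
  · rw [hP.coneSign_of_mem_subgroup hg, hP.coneSign_of_mem_subgroup (C.mul_mem hc hg)]
  · rw [hP.coneSign_of_inv_mem hg, hP.coneSign_of_inv_mem]
    simpa using hP.mul_mem_of_mem_right hg (C.inv_mem hc)

theorem coneSign_mul_right (g : G) (hc : c ∈ C) : coneSign P (g * c) = coneSign P g := by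
  rw [← neg_inj, ← hP.coneSign_inv, ← hP.coneSign_inv, mul_inv_rev,
    hP.coneSign_mul_left (C.inv_mem hc)]

theorem abs_coneSign_mul_sub_le_one (g h : G) :
    |coneSign P (g * h) - coneSign P g - coneSign P h| ≤ 1 := by
  rcases hP.cover g with hg | hg | hg
  · rcases hP.cover h with hh | hh | hh
    · simp [coneSign_of_mem hg, coneSign_of_mem hh, coneSign_of_mem (hP.mul_mem g hg h hh)]
    · simp [hP.coneSign_mul_right g hh, hP.coneSign_of_mem_subgroup hh]
    · simpa [coneSign_of_mem hg, hP.coneSign_of_inv_mem hh] using abs_coneSign_le_one (g * h)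
  · simp [hP.coneSign_mul_left hg, hP.coneSign_of_mem_subgroup hg]
  · rcases hP.cover h with hh | hh | hh
    · simpa [coneSign_of_mem hh, hP.coneSign_of_inv_mem hg] using abs_coneSign_le_one (g * h)
    · simp [hP.coneSign_mul_right g hh, hP.coneSign_of_mem_subgroup hh]
    · have hgh : (g * h)⁻¹ ∈ P := by simpa using hP.mul_mem _ hh _ hg
      simp [hP.coneSign_of_inv_mem hg, hP.coneSign_of_inv_mem hh, hP.coneSign_of_inv_mem hgh]

end IsRelPositiveCone

end Sign

section Jump

variable {ι : Type*} [LinearOrder ι]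

/-- The contribution to the quasi-morphism of passing from a syllable in the factor `i` to a
syllable in the factor `j`; the value `none` stands for the ends of the expression. -/
def jump : Option ι → Option ι → ℤ
  | some i, some j => if i < j then 1 else if j < i then -1 else 0
  | _, _ => 0

theorem jump_none_left (o : Option ι) : jump none o = 0 := rfl

theorem jump_none_right (o : Option ι) : jump o none = 0 := by cases o <;> rfl

theorem jump_swap (o o' : Option ι) : jump o' o = -jump o o' := by
  rcases o with _ | i <;> rcases o' with _ | j
  · rfl
  · rfl
  · rfl
  simp only [jump]
  split_ifs <;> first | rfl | order

theorem abs_jump_le_one (o o' : Option ι) : |jump o o'| ≤ 1 := by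
  unfold jump
  split
  · split_ifs <;> simp
  · simp

-- Two jumps of the same sign along a cycle of length three force the third one to be opposite.
theorem abs_jump_add_jump_add_jump_le_one (o k i : Option ι) :
    |jump o k + jump k i + jump i o| ≤ 1 := by
  rcases o with _ | o
  · simpa [jump_none_left, jump_none_right] using abs_jump_le_one k i
  rcases k with _ | k
  · simpa [jump_none_left, jump_none_right] using abs_jump_le_one i (some o)
  rcases i with _ | i
  · simpa [jump_none_left, jump_none_right] using abs_jump_le_one (some o) (some k)
  simp only [jump]
  split_ifs <;> first | simp; done | order

theorem odd_jump {i j : ι} (h : i ≠ j) : Odd (jump (some i) (some j)) := by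
  rcases h.lt_or_gt with h | h <;> simp [jump, h, h.not_gt]

end Jump

/-! ### Reduced expressions in amalgamated free products -/

section Syllables

variable {ι : Type*} {G : ι → Type*}

/-- The index of the first syllable of a list of syllables. -/
def headIndex (l : List (Σ i, G i)) : Option ι := l.head?.map Sigma.fst

theorem headIndex_nil : headIndex ([] : List (Σ i, G i)) = none := rfl

theorem headIndex_cons (a : Σ i, G i) (l : List (Σ i, G i)) : headIndex (a :: l) = some a.1 := rfl

variable [∀ i, Group (G i)]

/-- The list of syllables that represents the quotient `u⁻¹ w`. -/
def invAppend : List (Σ i, G i) → List (Σ i, G i) → List (Σ i, G i)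
  | [], w => w
  | a :: u, w => invAppend u (⟨a.1, a.2⁻¹⟩ :: w)

variable {H : Type*} [Group H] {φ : ∀ i, H →* G i}

variable (φ) in
/-- A list of syllables is reduced if consecutive syllables lie in different factors and no syllable
lies in the amalgamated subgroup. -/
def IsReducedList (l : List (Σ i, G i)) : Prop :=
  l.IsChain (fun a b => a.1 ≠ b.1) ∧ ∀ a ∈ l, a.2 ∉ (φ a.1).range

variable (φ) in
/-- The element represented by a list of syllables. -/
def syllableProd (l : List (Σ i, G i)) : Monoid.PushoutI φ :=
  (l.map fun a => Monoid.PushoutI.of a.1 a.2).prod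

/-- A reduced expression of `g`: the syllables are followed by an element of the amalgamated
subgroup. -/
def IsReducedExpr (l : List (Σ i, G i)) (g : Monoid.PushoutI φ) : Prop :=
  IsReducedList φ l ∧ ∃ c, syllableProd φ l * Monoid.PushoutI.base φ c = g

variable {a : Σ i, G i} {l u w : List (Σ i, G i)} {g h : Monoid.PushoutI φ}

theorem syllableProd_nil : syllableProd φ ([] : List (Σ i, G i)) = 1 := rfl

theorem syllableProd_cons (a : Σ i, G i) (l : List (Σ i, G i)) :
    syllableProd φ (a :: l) = Monoid.PushoutI.of a.1 a.2 * syllableProd φ l := by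
  simp [syllableProd]

theorem isReducedList_nil : IsReducedList φ [] := ⟨.nil, by simp⟩

theorem isReducedList_cons :
    IsReducedList φ (a :: l) ↔
      headIndex l ≠ some a.1 ∧ a.2 ∉ (φ a.1).range ∧ IsReducedList φ l := by
  have h : (∀ b ∈ l.head?, a.1 ≠ b.1) ↔ headIndex l ≠ some a.1 := by
    cases l <;> simp [headIndex, eq_comm]
  simp only [IsReducedList, List.isChain_cons, List.forall_mem_cons, h]
  tauto

theorem syllableProd_invAppend (u w : List (Σ i, G i)) :
    syllableProd φ (invAppend u w) = (syllableProd φ u)⁻¹ * syllableProd φ w := by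
  induction u generalizing w with
  | nil => simp [invAppend, syllableProd_nil]
  | cons a u ih => simp [invAppend, ih, syllableProd_cons, mul_assoc]

theorem isReducedList_invAppend (hu : IsReducedList φ u) (hw : IsReducedList φ w)
    (h : ∀ i, headIndex u = some i → headIndex w ≠ some i) :
    IsReducedList φ (invAppend u w) := by
  induction u generalizing w with
  | nil => exact hw
  | cons a u ih =>
    obtain ⟨hau, ha, hu⟩ := isReducedList_cons.1 hu
    refine ih hu (isReducedList_cons.2 ⟨h a.1 rfl, by simpa using ha, hw⟩) ?_
    rintro i hi h
    exact hau (hi.trans h.symm)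

theorem IsReducedExpr.invAppend (hu : IsReducedList φ u) (hw : IsReducedExpr w g)
    (h : ∀ i, headIndex u = some i → headIndex w ≠ some i) :
    IsReducedExpr (invAppend u w) ((syllableProd φ u)⁻¹ * g) := by
  obtain ⟨hw, c, rfl⟩ := hw
  exact ⟨isReducedList_invAppend hu hw h, c, by rw [syllableProd_invAppend, mul_assoc]⟩

theorem ofCoprodI_prod_eq_syllableProd (W : Monoid.CoprodI.Word G) :
    Monoid.PushoutI.ofCoprodI W.prod = syllableProd φ W.toList := by
  simp [Monoid.CoprodI.Word.prod, map_list_prod, syllableProd, Function.comp_def]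

theorem isReducedList_toList {d : Monoid.PushoutI.NormalWord.Transversal φ}
    (W : Monoid.PushoutI.NormalWord d) : IsReducedList φ W.toList := by
  refine ⟨W.chain_ne, fun a ha hmem => W.ne_one a ha ?_⟩
  have h := (d.compl a.1).1 (a₁ := (1, ⟨a.2, W.normalized a.1 a.2 ha⟩))
    (a₂ := (⟨a.2, hmem⟩, ⟨1, d.one_mem a.1⟩)) (by simp)
  exact congrArg (fun x => (x.2 : G a.1)) h

theorem exists_isReducedExpr (hφ : ∀ i, Function.Injective (φ i)) (g : Monoid.PushoutI φ) :
    ∃ l, IsReducedExpr l g := by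
  classical
  obtain ⟨d⟩ := Monoid.PushoutI.NormalWord.transversal_nonempty φ hφ
  -- In a normal word the amalgamated part comes first, so we invert the one of `g⁻¹`.
  obtain ⟨W, hW⟩ := (Monoid.PushoutI.NormalWord.equiv (d := d)).symm.surjective g⁻¹
  refine ⟨invAppend W.toList [], isReducedList_invAppend (isReducedList_toList W)
    isReducedList_nil (by simp [headIndex_nil]), W.head⁻¹, ?_⟩
  rw [syllableProd_invAppend, syllableProd_nil, mul_one, ← ofCoprodI_prod_eq_syllableProd,
    map_inv, ← mul_inv_rev, ← inv_eq_iff_eq_inv.2 hW]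
  rfl

theorem IsReducedExpr.eq_nil_iff (hφ : ∀ i, Function.Injective (φ i)) (hl : IsReducedExpr l g) :
    l = [] ↔ g ∈ (Monoid.PushoutI.base φ).range := by
  obtain ⟨hl, c, rfl⟩ := hl
  have hc : Monoid.PushoutI.base φ c ∈ (Monoid.PushoutI.base φ).range := ⟨c, rfl⟩
  rw [Subgroup.mul_mem_cancel_right _ hc]
  refine ⟨by rintro rfl; exact one_mem _, fun h => ?_⟩
  let W : Monoid.CoprodI.Word G :=
    ⟨l, fun a ha h1 => hl.2 a ha (h1 ▸ one_mem (φ a.1).range), hl.1⟩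
  have hW : Monoid.PushoutI.Reduced φ W := hl.2
  exact congrArg Monoid.CoprodI.Word.toList
    (hW.eq_empty_of_mem_range hφ (ofCoprodI_prod_eq_syllableProd (φ := φ) W ▸ h))

end Syllables

/-! ### The quasi-morphism of an amalgamated free product -/

section IsOrderingQuasimorphism

variable {G : Type*} [Group G] {τ : G → ℤ} {C : Subgroup G}

theorem isOrderingQuasimorphism_of_abs_le_one (hC : ∀ g ∈ C, τ g = 0) (hodd : ∀ g ∉ C, Odd (τ g))
    (hle : ∀ g h, |τ h - τ g - τ (g⁻¹ * h)| ≤ 1) : IsOrderingQuasimorphism τ C := by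
  have hinv : ∀ g, τ g⁻¹ = -τ g := fun g => by
    by_cases hg : g ∈ C
    · rw [hC g hg, hC _ (C.inv_mem hg), neg_zero]
    · obtain ⟨k, hk⟩ := hodd g hg
      obtain ⟨m, hm⟩ := hodd g⁻¹ (mt C.inv_mem_iff.1 hg)
      have h := hle g 1
      rw [hC 1 C.one_mem, mul_one, abs_le] at h
      omega
  have habs : ∀ g h, |τ g + τ h - τ (g * h)| ≤ 1 := fun g h => by
    simpa [hinv, add_comm] using hle g⁻¹ h
  refine ⟨⟨1, habs⟩, fun g => ⟨fun h => ?_, hC g⟩, fun g => by rw [hinv, neg_neg], fun g h => ?_⟩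
  · by_contra hg
    simpa [h] using hodd g hg
  · rw [hinv]
    exact (abs_le.1 (habs g h)).2

namespace IsOrderingQuasimorphism

variable (hτ : IsOrderingQuasimorphism τ C)
include hτ

theorem mul_pos {g h : G} (hg : 0 < τ g) (hh : 0 < τ h) : 0 < τ (g * h) := by
  have hle := hτ.le_one g h
  have hinv := hτ.inv (g * h)
  omega

theorem isRelPositiveCone : IsRelPositiveCone C {g | 0 < τ g} where
  mul_mem _ hg _ hh := hτ.mul_pos hg hh
  cover g := by
    rcases lt_trichotomy 0 (τ g) with h | h | h
    · exact Or.inl h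
    · exact Or.inr (Or.inl ((hτ.kernel g).1 h.symm))
    · exact Or.inr (Or.inr (neg_neg_iff_pos.1 (hτ.inv g ▸ h)))
  disjoint_left g hg hC := hg.ne' ((hτ.kernel g).2 hC)
  disjoint_inv g hg hg' := by
    have h : 0 < -τ g⁻¹ := hτ.inv g ▸ hg
    exact (neg_pos.1 h).not_gt hg'

end IsOrderingQuasimorphism

end IsOrderingQuasimorphism

section AmalgamQuasi

variable {ι : Type*} [LinearOrder ι] {G : ι → Type*} [∀ i, Group (G i)] (P : ∀ i, Set (G i))

/-- The sum of the signs of the syllables and of the jumps between consecutive syllables. -/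
noncomputable def syllableSum : List (Σ i, G i) → ℤ
  | [] => 0
  | a :: l => coneSign (P a.1) a.2 + jump (some a.1) (headIndex l) + syllableSum l

variable {P} {H : Type*} [Group H] {φ : ∀ i, H →* G i} {a : Σ i, G i} {l u w : List (Σ i, G i)}
  {g h : Monoid.PushoutI φ} (hP : ∀ i, IsRelPositiveCone (φ i).range (P i))
include hP

theorem syllableSum_invAppend (u w : List (Σ i, G i)) :
    syllableSum P (invAppend u w) =
      syllableSum P w - syllableSum P u + jump (headIndex u) (headIndex w) := by
  induction u generalizing w with
  | nil => simp [invAppend, syllableSum, headIndex_nil, jump_none_left]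
  | cons a u ih =>
    rw [invAppend, ih, syllableSum, syllableSum, (hP a.1).coneSign_inv, headIndex_cons,
      headIndex_cons, jump_swap (some a.1) (headIndex u)]
    ring

theorem odd_syllableSum (hl : IsReducedList φ l) (hne : l ≠ []) : Odd (syllableSum P l) := by
  induction l with
  | nil => contradiction
  | cons a l ih =>
    obtain ⟨hal, ha, hl⟩ := isReducedList_cons.1 hl
    have hsign := (hP a.1).odd_coneSign ha
    cases l with
    | nil => simpa [syllableSum, headIndex_nil, jump_none_right] using hsign
    | cons b l =>
      have hjump := odd_jump (i := a.1) (j := b.1) fun hab => hal (congrArg some hab.symm)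
      exact (hsign.add_odd hjump).add_odd (ih hl (List.cons_ne_nil b l))

theorem IsReducedExpr.exists_base_mul (hl : IsReducedExpr l g) (c : H) :
    ∃ l', IsReducedExpr l' (Monoid.PushoutI.base φ c * g) ∧ headIndex l' = headIndex l ∧
      syllableSum P l' = syllableSum P l := by
  obtain ⟨hl, d, rfl⟩ := hl
  cases l with
  | nil => exact ⟨[], ⟨hl, c * d, by simp [syllableProd_nil]⟩, rfl, rfl⟩
  | cons a l =>
    obtain ⟨hal, ha, hl⟩ := isReducedList_cons.1 hl
    have hc : φ a.1 c ∈ (φ a.1).range := ⟨c, rfl⟩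
    have hca : φ a.1 c * a.2 ∉ (φ a.1).range := mt (Subgroup.mul_mem_cancel_left _ hc).1 ha
    refine ⟨⟨a.1, φ a.1 c * a.2⟩ :: l, ⟨isReducedList_cons.2 ⟨hal, hca, hl⟩, d, ?_⟩, rfl, ?_⟩
    · simp [syllableProd_cons, mul_assoc, Monoid.PushoutI.of_apply_eq_base]
    · rw [syllableSum, syllableSum, (hP a.1).coneSign_mul_left hc]

theorem exists_isReducedExpr_inv_mul_of_headIndex_ne (hu : IsReducedList φ u)
    (hw : IsReducedExpr w h) (hne : ∀ i, headIndex u = some i → headIndex w ≠ some i)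
    (o : Option ι) :
    ∃ v, IsReducedExpr v ((syllableProd φ u)⁻¹ * h) ∧
      |jump o (headIndex w) + syllableSum P w - (jump o (headIndex u) + syllableSum P u) -
        syllableSum P v| ≤ 1 := by
  refine ⟨invAppend u w, hw.invAppend hu hne, ?_⟩
  rw [syllableSum_invAppend hP]
  convert abs_jump_add_jump_add_jump_le_one o (headIndex w) (headIndex u) using 2
  rw [jump_swap o (headIndex u), jump_swap (headIndex u) (headIndex w)]
  ring

theorem exists_isReducedExpr_inv_mul_of_inv_mul_notMem {i : ι} {a b : G i}
    (hu : IsReducedList φ (⟨i, a⟩ :: u)) (hw : IsReducedExpr (⟨i, b⟩ :: w) h)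
    (hab : a⁻¹ * b ∉ (φ i).range) (o : Option ι) :
    ∃ v, IsReducedExpr v ((syllableProd φ (⟨i, a⟩ :: u))⁻¹ * h) ∧
      |jump o (some i) + syllableSum P (⟨i, b⟩ :: w) -
        (jump o (some i) + syllableSum P (⟨i, a⟩ :: u)) - syllableSum P v| ≤ 1 := by
  obtain ⟨hw, c, rfl⟩ := hw
  obtain ⟨hau, -, hu⟩ := isReducedList_cons.1 hu
  obtain ⟨hbw, -, hw⟩ := isReducedList_cons.1 hw
  refine ⟨invAppend u (⟨i, a⁻¹ * b⟩ :: w), ⟨?_, c, ?_⟩, ?_⟩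
  · refine isReducedList_invAppend hu (isReducedList_cons.2 ⟨hbw, hab, hw⟩) fun j hj hji => ?_
    exact hau (hj.trans hji.symm)
  · simp [syllableProd_invAppend, syllableProd_cons, mul_assoc]
  · have hsign := (hP i).abs_coneSign_mul_sub_le_one a (a⁻¹ * b)
    rw [mul_inv_cancel_left] at hsign
    rw [syllableSum_invAppend hP]
    convert hsign using 2
    simp only [syllableSum, headIndex_cons]
    rw [jump_swap (some i) (headIndex u)]
    ring

/-- The syllable `o` before both lists makes the estimate inductive: a common initial coset can be
cancelled, after which it plays the role of `o`. -/
theorem exists_isReducedExpr_inv_mul (hu : IsReducedList φ u) (hw : IsReducedExpr w h)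
    (o : Option ι) :
    ∃ v, IsReducedExpr v ((syllableProd φ u)⁻¹ * h) ∧
      |jump o (headIndex w) + syllableSum P w - (jump o (headIndex u) + syllableSum P u) -
        syllableSum P v| ≤ 1 := by
  induction u generalizing w h o with
  | nil =>
    exact exists_isReducedExpr_inv_mul_of_headIndex_ne hP hu hw (by simp [headIndex_nil]) o
  | cons a u ih =>
    by_cases hne : headIndex w = some a.1
    swap
    · exact exists_isReducedExpr_inv_mul_of_headIndex_ne hP hu hw
        (by rintro _ ⟨rfl⟩; exact hne) o
    obtain ⟨i, a⟩ := a
    obtain _ | ⟨⟨j, b⟩, w⟩ := w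
    · contradiction
    obtain rfl : j = i := Option.some_injective _ hne
    by_cases hab : a⁻¹ * b ∈ (φ j).range
    swap
    · exact exists_isReducedExpr_inv_mul_of_inv_mul_notMem hP hu hw hab o
    obtain ⟨c, hc⟩ := hab
    obtain rfl : b = a * φ j c := eq_mul_of_inv_mul_eq hc.symm
    obtain ⟨hw, d, rfl⟩ := hw
    have hw' : IsReducedExpr w (syllableProd φ w * Monoid.PushoutI.base φ d) :=
      ⟨(isReducedList_cons.1 hw).2.2, d, rfl⟩
    obtain ⟨w', hw', hhead, hsum⟩ := hw'.exists_base_mul hP c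
    obtain ⟨v, hv, hle⟩ := ih (isReducedList_cons.1 hu).2.2 hw' (some j)
    refine ⟨v, ?_, ?_⟩
    · convert hv using 1
      simp [syllableProd_cons, mul_assoc, Monoid.PushoutI.of_apply_eq_base]
    · convert hle using 2
      rw [syllableSum, syllableSum, hhead, hsum, (hP j).coneSign_mul_right a ⟨c, rfl⟩,
        headIndex_cons, headIndex_cons]
      ring

theorem IsReducedExpr.exists_inv_mul (hu : IsReducedExpr u g) (hw : IsReducedExpr w h) :
    ∃ v, IsReducedExpr v (g⁻¹ * h) ∧
      |syllableSum P w - syllableSum P u - syllableSum P v| ≤ 1 := by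
  obtain ⟨hu, c, rfl⟩ := hu
  obtain ⟨v, hv, hle⟩ := exists_isReducedExpr_inv_mul hP hu hw none
  obtain ⟨v', hv', -, hsum⟩ := hv.exists_base_mul hP c⁻¹
  refine ⟨v', by convert hv' using 1; simp [mul_assoc], ?_⟩
  rwa [hsum, ← zero_add (syllableSum P w), ← zero_add (syllableSum P u)]

variable (hφ : ∀ i, Function.Injective (φ i))
include hφ

theorem IsReducedExpr.syllableSum_eq (hu : IsReducedExpr u g) (hw : IsReducedExpr w g) :
    syllableSum P u = syllableSum P w := by
  by_cases hg : g ∈ (Monoid.PushoutI.base φ).range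
  · rw [(hu.eq_nil_iff hφ).2 hg, (hw.eq_nil_iff hφ).2 hg]
  obtain ⟨v, hv, hle⟩ := hu.exists_inv_mul hP hw
  obtain rfl : v = [] := (hv.eq_nil_iff hφ).2 (inv_mul_cancel g ▸ one_mem _)
  -- Both sums are odd and they differ by at most one.
  obtain ⟨k, hk⟩ := odd_syllableSum hP hu.1 (mt (hu.eq_nil_iff hφ).1 hg)
  obtain ⟨m, hm⟩ := odd_syllableSum hP hw.1 (mt (hw.eq_nil_iff hφ).1 hg)
  rw [syllableSum, abs_le] at hle
  omega

omit hP hφ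

open Classical in
/-- The ordering quasi-morphism of an amalgamated free product: the `syllableSum` of any reduced
expression. For injective `φ i` every element has one, and the value `0` of the last branch is a
junk value. -/
noncomputable def amalgamQuasi (φ : ∀ i, H →* G i) (P : ∀ i, Set (G i))
    (g : Monoid.PushoutI φ) : ℤ :=
  if h : ∃ l, IsReducedExpr l g then syllableSum P h.choose else 0

theorem IsReducedExpr.amalgamQuasi_eq (hP : ∀ i, IsRelPositiveCone (φ i).range (P i))
    (hφ : ∀ i, Function.Injective (φ i)) (hl : IsReducedExpr l g) :
    amalgamQuasi φ P g = syllableSum P l := by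
  have h : ∃ l, IsReducedExpr l g := ⟨l, hl⟩
  rw [amalgamQuasi, dif_pos h]
  exact h.choose_spec.syllableSum_eq hP hφ hl

theorem amalgamQuasi_eq_zero (hP : ∀ i, IsRelPositiveCone (φ i).range (P i))
    (hφ : ∀ i, Function.Injective (φ i)) (hg : g ∈ (Monoid.PushoutI.base φ).range) :
    amalgamQuasi φ P g = 0 := by
  obtain ⟨l, hl⟩ := exists_isReducedExpr hφ g
  rw [hl.amalgamQuasi_eq hP hφ, (hl.eq_nil_iff hφ).2 hg, syllableSum]

theorem odd_amalgamQuasi (hP : ∀ i, IsRelPositiveCone (φ i).range (P i))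
    (hφ : ∀ i, Function.Injective (φ i)) (hg : g ∉ (Monoid.PushoutI.base φ).range) :
    Odd (amalgamQuasi φ P g) := by
  obtain ⟨l, hl⟩ := exists_isReducedExpr hφ g
  rw [hl.amalgamQuasi_eq hP hφ]
  exact odd_syllableSum hP hl.1 (mt (hl.eq_nil_iff hφ).1 hg)

theorem odd_or_amalgamQuasi_eq_zero (hP : ∀ i, IsRelPositiveCone (φ i).range (P i))
    (hφ : ∀ i, Function.Injective (φ i)) (g : Monoid.PushoutI φ) :
    Odd (amalgamQuasi φ P g) ∨ amalgamQuasi φ P g = 0 :=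
  (em' (g ∈ (Monoid.PushoutI.base φ).range)).imp (odd_amalgamQuasi hP hφ)
    (amalgamQuasi_eq_zero hP hφ)

theorem isOrderingQuasimorphism_amalgamQuasi (hP : ∀ i, IsRelPositiveCone (φ i).range (P i))
    (hφ : ∀ i, Function.Injective (φ i)) :
    IsOrderingQuasimorphism (amalgamQuasi φ P) (Monoid.PushoutI.base φ).range := by
  refine isOrderingQuasimorphism_of_abs_le_one (fun g => amalgamQuasi_eq_zero hP hφ)
    (fun g => odd_amalgamQuasi hP hφ) fun g h => ?_
  obtain ⟨u, hu⟩ := exists_isReducedExpr hφ g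
  obtain ⟨w, hw⟩ := exists_isReducedExpr hφ h
  obtain ⟨v, hv, hle⟩ := hu.exists_inv_mul hP hw
  rwa [hu.amalgamQuasi_eq hP hφ, hw.amalgamQuasi_eq hP hφ, hv.amalgamQuasi_eq hP hφ]

end AmalgamQuasi

/-! ### Words of syllables -/

section SyllableWords

variable {ι Y : Type*} {X : ι → Type*}

/-- The word over the generators of an amalgamated free product that spells a list of syllables. -/
def syllableConcat (l : List (Σ i, List (X i))) : List (Y ⊕ (Σ i, X i)) :=
  l.flatMap fun a => a.2.map fun x => Sum.inr ⟨a.1, x⟩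

theorem syllableConcat_cons (a : Σ i, List (X i)) (l : List (Σ i, List (X i))) :
    syllableConcat (a :: l) =
      (a.2.map fun x => Sum.inr ⟨a.1, x⟩ : List (Y ⊕ (Σ i, X i))) ++ syllableConcat l := rfl

/-- A list of syllables is admissible if consecutive syllables lie over different alphabets and
every syllable lies in one of the two given languages over its alphabet. -/
def IsSyllableList (K : ∀ i, Bool → Language (X i)) (l : List (Σ i, List (X i))) : Prop :=
  l.IsChain (fun a b => a.1 ≠ b.1) ∧ ∀ a ∈ l, ∃ b, a.2 ∈ K a.1 b

variable {K : ∀ i, Bool → Language (X i)}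

theorem isSyllableList_nil : IsSyllableList K [] := ⟨.nil, by simp⟩

theorem isSyllableList_cons {a : Σ i, List (X i)} {l : List (Σ i, List (X i))} :
    IsSyllableList K (a :: l) ↔
      headIndex l ≠ some a.1 ∧ (∃ b, a.2 ∈ K a.1 b) ∧ IsSyllableList K l := by
  have h : (∀ b ∈ l.head?, a.1 ≠ b.1) ↔ headIndex l ≠ some a.1 := by
    cases l <;> simp [headIndex, eq_comm]
  simp only [IsSyllableList, List.isChain_cons, List.forall_mem_cons, h]
  tauto

theorem mem_syllableWords_iff {w : List (Y ⊕ (Σ i, X i))} :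
    w ∈ syllableWords (fun i => K i true) (fun i => K i false) ↔
      ∃ l, ∃ z : List Y, IsSyllableList K l ∧ w = syllableConcat l ++ z.map Sum.inl := by
  simp only [IsSyllableList, Bool.exists_bool, or_comm (a := _ ∈ K _ false), and_assoc]
  rfl

variable {G : ι → Type*} [∀ i, Group (G i)] (p : ∀ i, X i → G i)

/-- The elements of the factors represented by the syllables. -/
def syllableEval (l : List (Σ i, List (X i))) : List (Σ i, G i) :=
  l.map fun a => ⟨a.1, eval (p a.1) a.2⟩

theorem syllableEval_cons (a : Σ i, List (X i)) (l : List (Σ i, List (X i))) :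
    syllableEval p (a :: l) = ⟨a.1, eval (p a.1) a.2⟩ :: syllableEval p l := rfl

theorem headIndex_syllableEval (l : List (Σ i, List (X i))) :
    headIndex (syllableEval p l) = headIndex l := by
  cases l <;> rfl

variable {p} {H : Type*} [Group H] {φ : ∀ i, H →* G i}

theorem eval_amalgamGens_syllable (q : Y → H) (i : ι) (u : List (X i)) :
    eval (amalgamGens φ p q) (u.map fun x => Sum.inr ⟨i, x⟩) =
      Monoid.PushoutI.of i (eval (p i) u) := by
  simp [eval, map_list_prod, Function.comp_def, amalgamGens]

theorem eval_amalgamGens_tail (q : Y → H) (z : List Y) :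
    eval (amalgamGens φ p q) (z.map Sum.inl) = Monoid.PushoutI.base φ (eval q z) := by
  simp [eval, map_list_prod, Function.comp_def, amalgamGens]

theorem eval_amalgamGens_syllableConcat (q : Y → H) (l : List (Σ i, List (X i))) :
    eval (amalgamGens φ p q) (syllableConcat l) = syllableProd φ (syllableEval p l) := by
  induction l with
  | nil => rfl
  | cons a l ih =>
    rw [syllableConcat_cons, eval_append, eval_amalgamGens_syllable, ih, syllableEval_cons,
      syllableProd_cons]

theorem IsSyllableList.isReducedList_syllableEval
    (hK : ∀ i b, ∀ u ∈ K i b, eval (p i) u ∉ (φ i).range) {l : List (Σ i, List (X i))}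
    (hl : IsSyllableList K l) : IsReducedList φ (syllableEval p l) := by
  induction l with
  | nil => exact isReducedList_nil
  | cons a l ih =>
    obtain ⟨hne, ⟨b, ha⟩, hl⟩ := isSyllableList_cons.1 hl
    rw [syllableEval_cons, isReducedList_cons, headIndex_syllableEval]
    exact ⟨hne, hK a.1 b a.2 ha, ih hl⟩

theorem IsSyllableList.isReducedExpr_syllableEval
    (hK : ∀ i b, ∀ u ∈ K i b, eval (p i) u ∉ (φ i).range) (q : Y → H)
    {l : List (Σ i, List (X i))} (hl : IsSyllableList K l) (z : List Y) :
    IsReducedExpr (syllableEval p l)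
      (eval (amalgamGens φ p q) (syllableConcat l ++ z.map Sum.inl)) := by
  refine ⟨hl.isReducedList_syllableEval hK, eval q z, ?_⟩
  rw [eval_append, eval_amalgamGens_syllableConcat, eval_amalgamGens_tail]

theorem IsReducedList.exists_isSyllableList
    (hK : ∀ i, ∀ g ∉ (φ i).range, ∃ b, ∃ u ∈ K i b, eval (p i) u = g) {l : List (Σ i, G i)}
    (hl : IsReducedList φ l) : ∃ l', IsSyllableList K l' ∧ syllableEval p l' = l := by
  induction l with
  | nil => exact ⟨[], isSyllableList_nil, rfl⟩
  | cons a l ih =>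
    obtain ⟨i, g⟩ := a
    obtain ⟨hne, hg, hl⟩ := isReducedList_cons.1 hl
    obtain ⟨l', hl', rfl⟩ := ih hl
    obtain ⟨b, u, hu, rfl⟩ := hK i g hg
    rw [headIndex_syllableEval] at hne
    exact ⟨⟨i, u⟩ :: l', isSyllableList_cons.2 ⟨hne, ⟨b, hu⟩, hl'⟩, rfl⟩

theorem exists_mem_syllableWords_eval_eq (hφ : ∀ i, Function.Injective (φ i)) {q : Y → H}
    (hq : IsGenerating q) (hK : ∀ i, ∀ g ∉ (φ i).range, ∃ b, ∃ u ∈ K i b, eval (p i) u = g)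
    (g : Monoid.PushoutI φ) :
    ∃ w ∈ syllableWords (fun i => K i true) (fun i => K i false),
      eval (amalgamGens φ p q) w = g := by
  obtain ⟨l, hl, c, rfl⟩ := exists_isReducedExpr hφ g
  obtain ⟨z, rfl⟩ := hq c
  obtain ⟨l', hl', rfl⟩ := hl.exists_isSyllableList hK
  refine ⟨_, mem_syllableWords_iff.2 ⟨l', z, hl', rfl⟩, ?_⟩
  rw [eval_append, eval_amalgamGens_syllableConcat, eval_amalgamGens_tail]

end SyllableWords

/-! ### The syllable transducer -/

/-- The states of the transducer that reads words of syllables: `before o` between two syllables,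
where `o` is the index of the last one; `inside i b s` in a syllable of index `i` and sign `b`;
`tail` in the final word over the generators of the amalgamated subgroup. -/
inductive SyllableState (ι : Type*) (σ : ι → Bool → Type*)
  | before (o : Option ι)
  | inside (i : ι) (b : Bool) (s : σ i b)
  | tail

instance {ι : Type*} {σ : ι → Bool → Type*} [Finite ι] [∀ i b, Finite (σ i b)] :
    Finite (SyllableState ι σ) := by
  let f : Option ι ⊕ (Σ i, Σ b, σ i b) ⊕ Unit → SyllableState ι σ
    | .inl o => .before o
    | .inr (.inl s) => .inside s.1 s.2.1 s.2.2
    | .inr (.inr _) => .tail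
  refine Finite.of_surjective f ?_
  rintro (o | ⟨i, b, s⟩ | _)
  · exact ⟨.inl o, rfl⟩
  · exact ⟨.inr (.inl ⟨i, b, s⟩), rfl⟩
  · exact ⟨.inr (.inr ()), rfl⟩

/-- The shortest word that evaluates to an integer in `{-1, 0, 1}`. -/
def signWord (k : ℤ) : List Bool := if 0 < k then [true] else if k < 0 then [false] else []

theorem evalInt_signWord {k : ℤ} (hk : |k| ≤ 1) : evalInt (signWord k) = k := by
  rw [abs_le] at hk
  unfold signWord
  split_ifs <;> simp [evalInt] <;> omega

theorem length_signWord_le_one (k : ℤ) : (signWord k).length ≤ 1 := by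
  unfold signWord
  split_ifs <;> simp

section SyllableTransducer

variable {ι Y : Type*} [LinearOrder ι] {X : ι → Type*} {σ : ι → Bool → Type*}
  (M : ∀ i b, DFA (X i) (σ i b))

/-- The moves of the syllable transducer. On entering a syllable it guesses the sign of the syllable
and writes this sign, after the jump from the preceding syllable. -/
inductive SyllableMove :
    SyllableState ι σ → Option (Y ⊕ (Σ i, X i)) → SyllableState ι σ → List Bool → Prop
  | enter (o : Option ι) (i : ι) (b : Bool) : o ≠ some i →
      SyllableMove (.before o) none (.inside i b (M i b).start)
        (signWord (jump o (some i)) ++ [b])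
  | read (i : ι) (b : Bool) (s : σ i b) (x : X i) :
      SyllableMove (.inside i b s) (some (.inr ⟨i, x⟩)) (.inside i b ((M i b).step s x)) []
  | leave (i : ι) (b : Bool) (s : σ i b) : s ∈ (M i b).accept →
      SyllableMove (.inside i b s) none (.before (some i)) []
  | finish (o : Option ι) : SyllableMove (.before o) none .tail []
  | readTail (y : Y) : SyllableMove .tail (some (.inl y)) .tail []

theorem SyllableMove.length_le_two {s s' : SyllableState ι σ} {x : Option (Y ⊕ (Σ i, X i))}
    {v : List Bool} (h : SyllableMove M s x s' v) : v.length ≤ 2 := by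
  cases h with
  | enter o i b _ => simpa using length_signWord_le_one (jump o (some i))
  | _ => simp

theorem finite_setOf_syllableMove [Finite ι] [∀ i b, Finite (σ i b)] (s : SyllableState ι σ)
    (x : Option (Y ⊕ (Σ i, X i))) :
    {m : SyllableState ι σ × List Bool | SyllableMove M s x m.1 m.2}.Finite :=
  (Set.finite_univ.prod (List.finite_length_le Bool 2)).subset fun _ hm =>
    ⟨Set.mem_univ _, hm.length_le_two⟩

/-- The transducer that reads the words of syllables accepted by the automata `M i b` and writes
their syllable sums. -/
noncomputable def syllableTransducer [Finite ι] [∀ i b, Finite (σ i b)] :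
    Transducer (SyllableState ι σ) (Y ⊕ (Σ i, X i)) Bool where
  step s x := (finite_setOf_syllableMove M s x).toFinset
  start := .before none
  accept := {.tail}

variable {M}

theorem mem_step_syllableTransducer [Finite ι] [∀ i b, Finite (σ i b)] {s s' : SyllableState ι σ}
    {x : Option (Y ⊕ (Σ i, X i))} {v : List Bool} :
    (s', v) ∈ (syllableTransducer M).step s x ↔ SyllableMove M s x s' v :=
  Set.Finite.mem_toFinset _

section Soundness

variable (M) {G : ι → Type*} [∀ i, Group (G i)] (p : ∀ i, X i → G i) (P : ∀ i, Set (G i))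

/-- `w` is a word of syllables that may follow a syllable of index `o`, and `v` evaluates to the
sum of its signs and jumps, including the first jump from `o`. -/
def IsSyllableReading (o : Option ι) (w : List (Y ⊕ (Σ i, X i))) (v : List Bool) : Prop :=
  ∃ l, ∃ z : List Y, IsSyllableList (fun i b => (M i b).accepts) l ∧
    (∀ i ∈ o, headIndex l ≠ some i) ∧ w = syllableConcat l ++ z.map Sum.inl ∧
    evalInt v = jump o (headIndex l) + syllableSum P (syllableEval p l)

/-- The invariant of the runs of the syllable transducer that end in `tail`: how the input `w` and
the output `v` depend on the initial state. -/
def IsReading : SyllableState ι σ → List (Y ⊕ (Σ i, X i)) → List Bool → Prop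
  | .before o, w, v => IsSyllableReading M p P o w v
  | .inside i b s, w, v => ∃ u w', (M i b).evalFrom s u ∈ (M i b).accept ∧
      w = (u.map fun x => Sum.inr ⟨i, x⟩) ++ w' ∧ IsSyllableReading M p P (some i) w' v
  | .tail, w, v => (∃ z : List Y, w = z.map Sum.inl) ∧ evalInt v = 0

variable {M p P}

theorem isSyllableReading_of_isReading_inside
    (hM : ∀ i b, ∀ u ∈ (M i b).accepts, coneSign (P i) (eval (p i) u) = evalInt [b])
    {o : Option ι} {i : ι} (ho : o ≠ some i) {b : Bool} {w : List (Y ⊕ (Σ i, X i))} {v : List Bool}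
    (h : IsReading M p P (.inside i b (M i b).start) w v) :
    IsSyllableReading M p P o w (signWord (jump o (some i)) ++ [b] ++ v) := by
  obtain ⟨u, _, hu, rfl, l, z, hl, hne, rfl, hv⟩ := h
  refine ⟨⟨i, u⟩ :: l, z, isSyllableList_cons.2 ⟨hne i rfl, ⟨b, hu⟩, hl⟩, ?_, ?_, ?_⟩
  · rintro j hj ⟨⟩
    exact ho hj
  · rw [syllableConcat_cons, List.append_assoc]
  · rw [evalInt_append, evalInt_append, evalInt_signWord (abs_jump_le_one o (some i)), hv,
      ← hM i b u hu, syllableEval_cons, syllableSum, headIndex_syllableEval, headIndex_cons]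
    ring

theorem SyllableMove.isReading
    (hM : ∀ i b, ∀ u ∈ (M i b).accepts, coneSign (P i) (eval (p i) u) = evalInt [b])
    {s s' : SyllableState ι σ} {x : Option (Y ⊕ (Σ i, X i))} {w : List (Y ⊕ (Σ i, X i))}
    {u v : List Bool} (h : SyllableMove M s x s' u) (h' : IsReading M p P s' w v) :
    IsReading M p P s (x.toList ++ w) (u ++ v) := by
  cases h with
  | enter o i b ho => exact isSyllableReading_of_isReading_inside hM ho h'
  | read i b s x =>
    obtain ⟨u, w, hu, rfl, h⟩ := h'
    exact ⟨x :: u, w, hu, rfl, h⟩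
  | leave i b s hs => exact ⟨[], w, hs, rfl, h'⟩
  | finish o =>
    obtain ⟨⟨z, rfl⟩, hv⟩ := h'
    exact ⟨[], z, isSyllableList_nil, by simp [headIndex_nil], rfl,
      by rw [headIndex_nil, jump_none_right]; exact hv⟩
  | readTail y =>
    obtain ⟨⟨z, rfl⟩, hv⟩ := h'
    exact ⟨⟨y :: z, rfl⟩, hv⟩

theorem isReading_of_run [Finite ι] [∀ i b, Finite (σ i b)]
    (hM : ∀ i b, ∀ u ∈ (M i b).accepts, coneSign (P i) (eval (p i) u) = evalInt [b])
    {s s' : SyllableState ι σ} {w : List (Y ⊕ (Σ i, X i))} {v : List Bool}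
    (h : (syllableTransducer M).Run s w s' v) (hs' : s' = .tail) : IsReading M p P s w v := by
  induction h with
  | refl s => exact hs' ▸ ⟨⟨[], rfl⟩, evalInt_nil⟩
  | move hm _ ih => exact (mem_step_syllableTransducer.1 hm).isReading hM (ih hs')

end Soundness

section Completeness

variable [Finite ι] [∀ i b, Finite (σ i b)]

theorem run_inside {i : ι} {b : Bool} {s : σ i b} {u : List (X i)}
    (hu : (M i b).evalFrom s u ∈ (M i b).accept) :
    (syllableTransducer (Y := Y) M).Run (.inside i b s) (u.map fun x => Sum.inr ⟨i, x⟩)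
      (.before (some i)) [] := by
  induction u generalizing s with
  | nil => exact .single (mem_step_syllableTransducer.2 (.leave i b s hu))
  | cons x u ih => exact .move (mem_step_syllableTransducer.2 (.read i b s x)) (ih hu)

theorem run_tail (z : List Y) :
    (syllableTransducer M).Run .tail (z.map Sum.inl) .tail [] := by
  induction z with
  | nil => exact .refl _
  | cons y z ih => exact .move (mem_step_syllableTransducer.2 (.readTail y)) ih

theorem IsSyllableList.exists_run {l : List (Σ i, List (X i))}
    (hl : IsSyllableList (fun i b => (M i b).accepts) l) {o : Option ι}
    (ho : ∀ i ∈ o, headIndex l ≠ some i) (z : List Y) :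
    ∃ v, (syllableTransducer M).Run (.before o) (syllableConcat l ++ z.map Sum.inl) .tail v := by
  induction l generalizing o with
  | nil => exact ⟨_, .move (mem_step_syllableTransducer.2 (.finish o)) (run_tail z)⟩
  | cons a l ih =>
    obtain ⟨hne, ⟨b, ha⟩, hl⟩ := isSyllableList_cons.1 hl
    obtain ⟨v, hv⟩ := ih hl (o := some a.1) (by rintro i ⟨⟩; exact hne)
    have hoa : o ≠ some a.1 := fun h => ho a.1 h rfl
    have hrun := (run_inside (Y := Y) ha).trans hv
    rw [syllableConcat_cons, List.append_assoc]
    exact ⟨_, .move (mem_step_syllableTransducer.2 (.enter o a.1 b hoa)) hrun⟩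

theorem exists_mem_outputs_syllableTransducer {w : List (Y ⊕ (Σ i, X i))}
    (hw : w ∈ syllableWords (fun i => (M i true).accepts) (fun i => (M i false).accepts)) :
    ∃ v, v ∈ (syllableTransducer M).outputs w := by
  obtain ⟨l, z, hl, rfl⟩ := (mem_syllableWords_iff (K := fun i b => (M i b).accepts)).1 hw
  obtain ⟨v, hv⟩ := hl.exists_run (o := none) (by simp) z
  exact ⟨v, _, rfl, hv⟩

end Completeness

end SyllableTransducer

/-! ### Transducers of amalgamated free products -/

namespace IsTauTransducer

variable {G S X : Type*} [Group G] {p : X → G} {τ : G → ℤ} {T : Transducer S X Bool}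

theorem of_outputs_eq {S' : Type*} {T' : Transducer S' X Bool} (hT : IsTauTransducer T p τ)
    (h : T'.outputs = T.outputs) : IsTauTransducer T' p τ :=
  ⟨h ▸ hT.surj, h ▸ hT.compute⟩

theorem mem_preimage_posWords_iff (hT : IsTauTransducer T p τ) {w : List X} :
    w ∈ T.preimage posWords ↔ (∃ v, v ∈ T.outputs w) ∧ 0 < τ (eval p w) := by
  constructor
  · rintro ⟨v, hpos, hv⟩
    exact ⟨⟨v, hv⟩, hT.compute w v hv ▸ mem_posWords_iff.1 hpos⟩
  · rintro ⟨⟨v, hv⟩, hpos⟩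
    exact ⟨v, mem_posWords_iff.2 (hT.compute w v hv ▸ hpos), hv⟩

theorem image_eval_preimage_posWords (hT : IsTauTransducer T p τ) :
    eval p '' {w | w ∈ T.preimage posWords} = {g | 0 < τ g} := by
  ext g
  constructor
  · rintro ⟨w, hw, rfl⟩
    exact (hT.mem_preimage_posWords_iff.1 hw).2
  · intro hg
    obtain ⟨w, hw, rfl⟩ := hT.surj g
    exact ⟨w, hT.mem_preimage_posWords_iff.2 ⟨hw, hg⟩, rfl⟩

end IsTauTransducer

section Amalgam

variable {ι H Y : Type*} [Finite ι] {G X : ι → Type*} [LinearOrder ι] [Group H]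
  [∀ i, Group (G i)] {φ : ∀ i, H →* G i} {p : ∀ i, X i → G i} {q : Y → H} {P : ∀ i, Set (G i)}

section

variable {σ : ι → Bool → Type*} [∀ i b, Finite (σ i b)] {M : ∀ i b, DFA (X i) (σ i b)}

theorem mem_syllableWords_and_amalgamQuasi_eq (hφ : ∀ i, Function.Injective (φ i))
    (hP : ∀ i, IsRelPositiveCone (φ i).range (P i))
    (hM : ∀ i b, ∀ u ∈ (M i b).accepts, coneSign (P i) (eval (p i) u) = evalInt [b])
    {w : List (Y ⊕ (Σ i, X i))} {v : List Bool} (hv : v ∈ (syllableTransducer M).outputs w) :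
    w ∈ syllableWords (fun i => (M i true).accepts) (fun i => (M i false).accepts) ∧
      amalgamQuasi φ P (eval (amalgamGens φ p q) w) = evalInt v := by
  obtain ⟨s, hs, hrun⟩ := hv
  obtain ⟨l, z, hl, -, rfl, hsum⟩ := isReading_of_run hM hrun hs
  have hrange : ∀ i b, ∀ u ∈ (M i b).accepts, eval (p i) u ∉ (φ i).range := fun i b u hu hr => by
    have h := hM i b u hu
    rw [(hP i).coneSign_of_mem_subgroup hr] at h
    cases b <;> simp [evalInt] at h
  refine ⟨mem_syllableWords_iff.2 ⟨l, z, hl, rfl⟩, ?_⟩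
  rw [(hl.isReducedExpr_syllableEval hrange q z).amalgamQuasi_eq hP hφ, hsum, jump_none_left,
    zero_add]

theorem isTauTransducer_syllableTransducer (hφ : ∀ i, Function.Injective (φ i))
    (hq : IsGenerating q) (hP : ∀ i, IsRelPositiveCone (φ i).range (P i))
    (hM : ∀ i b, ∀ u ∈ (M i b).accepts, coneSign (P i) (eval (p i) u) = evalInt [b])
    (hsurj : ∀ i, ∀ g ∉ (φ i).range, ∃ b, ∃ u ∈ (M i b).accepts, eval (p i) u = g) :
    IsTauTransducer (syllableTransducer M) (amalgamGens φ p q) (amalgamQuasi φ P) where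
  surj g := by
    obtain ⟨w, hw, rfl⟩ := exists_mem_syllableWords_eval_eq hφ hq hsurj g
    exact ⟨w, exists_mem_outputs_syllableTransducer hw, rfl⟩
  compute w v hv := (mem_syllableWords_and_amalgamQuasi_eq hφ hP hM hv).2

end

theorem exists_isTauTransducer_amalgamQuasi (hφ : ∀ i, Function.Injective (φ i))
    (hq : IsGenerating q) (hP : ∀ i, IsRelPositiveCone (φ i).range (P i))
    {Lp Lm : ∀ i, Language (X i)} (hLp : ∀ i, (Lp i).IsRegular)
    (hLpP : ∀ i, eval (p i) '' {w | w ∈ Lp i} = P i) (hLm : ∀ i, (Lm i).IsRegular)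
    (hLmP : ∀ i, eval (p i) '' {w | w ∈ Lm i} = {g | g⁻¹ ∈ P i}) :
    ∃ (S : Type) (_ : Finite S) (T : Transducer S (Y ⊕ (Σ i, X i)) Bool),
      IsTauTransducer T (amalgamGens φ p q) (amalgamQuasi φ P) ∧
      ∀ w, (∃ v, v ∈ T.outputs w) ↔ w ∈ syllableWords Lp Lm := by
  choose σp hσp Mp hMp using hLp
  choose σm hσm Mm hMm using hLm
  let σ : ι → Bool → Type := fun i b => cond b (σp i) (σm i)
  have : ∀ i b, Finite (σ i b) := fun i b => by cases b <;> simp only [σ, cond] <;> infer_instance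
  let M : ∀ i b, DFA (X i) (σ i b) := fun i b =>
    match b with
    | true => Mp i
    | false => Mm i
  have hsign : ∀ i b, ∀ u ∈ (M i b).accepts, coneSign (P i) (eval (p i) u) = evalInt [b] := by
    rintro i (_ | _) u hu
    · have h : eval (p i) u ∈ {g | g⁻¹ ∈ P i} := hLmP i ▸ ⟨u, hMm i ▸ hu, rfl⟩
      exact (hP i).coneSign_of_inv_mem h
    · exact coneSign_of_mem (hLpP i ▸ ⟨u, hMp i ▸ hu, rfl⟩)
  have hsurj : ∀ i, ∀ g ∉ (φ i).range, ∃ b, ∃ u ∈ (M i b).accepts, eval (p i) u = g := by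
    intro i g hg
    rcases (hP i).cover g with h | h | h
    · rw [← hLpP i, ← hMp i] at h
      exact ⟨true, h⟩
    · exact absurd h hg
    · have h' : g ∈ {g | g⁻¹ ∈ P i} := h
      rw [← hLmP i, ← hMm i] at h'
      exact ⟨false, h'⟩
  obtain ⟨S, hS, T, hT, -⟩ := (syllableTransducer (Y := Y) M).exists_outputs_eq_of_finite
    Set.finite_univ (Set.mem_univ _) fun _ _ _ _ _ => Set.mem_univ _
  refine ⟨S, hS, T, (isTauTransducer_syllableTransducer hφ hq hP hsign hsurj).of_outputs_eq hT,
    fun w => ?_⟩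
  rw [hT, ← funext hMp, ← funext hMm]
  exact ⟨fun ⟨v, hv⟩ => (mem_syllableWords_and_amalgamQuasi_eq (q := q) hφ hP hsign hv).1,
    exists_mem_outputs_syllableTransducer (M := M)⟩

end Amalgam

/-! ### Pullbacks and free products -/

section Pullback

variable {G G' S X X' : Type*} [Group G] [Group G']

theorem IsRelPositiveCone.comap {C : Subgroup G'} {P : Set G'} (hP : IsRelPositiveCone C P)
    (e : G →* G') : IsRelPositiveCone (C.comap e) (e ⁻¹' P) where
  mul_mem g hg h hh := by simpa using hP.mul_mem _ hg _ hh
  cover g := by simpa using hP.cover (e g)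
  disjoint_left g hg := hP.disjoint_left (e g) hg
  disjoint_inv g hg := by simpa using hP.disjoint_inv (e g) hg

theorem IsOrderingQuasimorphism.comp {τ : G' → ℤ} {C : Subgroup G'}
    (hτ : IsOrderingQuasimorphism τ C) (e : G →* G') :
    IsOrderingQuasimorphism (τ ∘ e) (C.comap e) where
  quasi := hτ.quasi.imp fun D hD g h => by simpa using hD (e g) (e h)
  kernel g := hτ.kernel (e g)
  inv g := by simpa using hτ.inv (e g)
  le_one g h := by simpa using hτ.le_one (e g) (e h)

variable {p : X → G} {p' : X' → G'} {e : G →* G'} {f : X → X'} (hpe : ∀ x, e (p x) = p' (f x))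
include hpe

theorem map_eval_eq_eval_map (w : List X) : e (eval p w) = eval p' (w.map f) := by
  simp [eval, map_list_prod, Function.comp_def, hpe]

variable (he : Function.Injective e) (hf : Function.Surjective f)
include he hf

theorem exists_eval_eq_of_map_eq {g : G} {w' : List X'} (h : eval p' w' = e g) :
    ∃ w, w.map f = w' ∧ eval p w = g := by
  obtain ⟨w, rfl⟩ := List.map_surjective_iff.2 hf w'
  exact ⟨w, rfl, he ((map_eval_eq_eval_map hpe w).trans h)⟩

theorem IsGenerating.of_injective (hp' : IsGenerating p') : IsGenerating p := fun g =>
  let ⟨_, hw'⟩ := hp' (e g)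
  let ⟨w, _, hw⟩ := exists_eval_eq_of_map_eq hpe he hf hw'
  ⟨w, hw⟩

theorem image_eval_preimage_map (L : Language X') :
    eval p '' {w | w.map f ∈ L} = e ⁻¹' (eval p' '' {w | w ∈ L}) := by
  ext g
  constructor
  · rintro ⟨w, hw, rfl⟩
    exact ⟨w.map f, hw, (map_eval_eq_eval_map hpe w).symm⟩
  · rintro ⟨_, hw, h⟩
    obtain ⟨w, rfl, rfl⟩ := exists_eval_eq_of_map_eq hpe he hf h
    exact ⟨w, hw, rfl⟩

theorem IsTauTransducer.comap {T : Transducer S X' Bool} {τ : G' → ℤ}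
    (hT : IsTauTransducer T p' τ) : IsTauTransducer (T.comap f) p (τ ∘ e) where
  surj g := by
    obtain ⟨_, hv, h⟩ := hT.surj (e g)
    obtain ⟨w, rfl, hw⟩ := exists_eval_eq_of_map_eq hpe he hf h
    exact ⟨w, by rwa [Transducer.outputs_comap], hw⟩
  compute w v hv := by
    rw [Transducer.outputs_comap] at hv
    rw [Function.comp_apply, map_eval_eq_eval_map hpe]
    exact hT.compute _ v hv

end Pullback

section HasRegularCone

variable {G X : Type*} [Group G]

/-- Some regular language over the generating set `(X, p)` evaluates onto a positive cone relative
to `C`. -/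
def HasRegularCone (C : Subgroup G) (p : X → G) : Prop :=
  ∃ L : Language X, L.IsRegular ∧ IsRelPositiveCone C (eval p '' {w | w ∈ L})

theorem HasRegularCone.of_injective {G' X' : Type*} [Group G'] {C : Subgroup G'} {p : X → G}
    {p' : X' → G'} {e : G →* G'} {f : X → X'} (hpe : ∀ x, e (p x) = p' (f x))
    (he : Function.Injective e) (hf : Function.Surjective f) (h : HasRegularCone C p') :
    HasRegularCone (C.comap e) p := by
  obtain ⟨L, ⟨σ, hσ, M, rfl⟩, hcone⟩ := h
  refine ⟨_, ⟨σ, hσ, M.comap f, rfl⟩, ?_⟩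
  rw [DFA.accepts_comap]
  exact image_eval_preimage_map hpe he hf M.accepts ▸ hcone.comap e

theorem HasRegularCone.ulift {p : X → G} (h : HasRegularCone ⊥ p) :
    HasRegularCone ⊥ fun x : ULift X => ULift.up (p x.down) := by
  have he : Function.Injective (MulEquiv.ulift (α := G)).toMonoidHom := MulEquiv.ulift.injective
  rw [← (MonoidHom.ker_eq_bot_iff _).2 he]
  exact h.of_injective (p := fun x : ULift X => ULift.up (p x.down)) (f := ULift.down)
    (fun _ => rfl) he ULift.down_surjective

theorem IsGenerating.ulift {p : X → G} (h : IsGenerating p) :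
    IsGenerating fun x : ULift X => ULift.up (p x.down) :=
  h.of_injective (p := fun x : ULift X => ULift.up (p x.down)) (f := ULift.down)
    (e := (MulEquiv.ulift (α := G)).toMonoidHom) (fun _ => rfl)
    MulEquiv.ulift.injective ULift.down_surjective

end HasRegularCone

section LeftOrder

variable {G X : Type*} [Group G]

theorem IsLeftOrder.isRelPositiveCone {lt : G → G → Prop} (h : IsLeftOrder lt) :
    IsRelPositiveCone ⊥ (positiveCone lt) where
  mul_mem a ha b hb := by
    refine h.trans 1 a (a * b) ha ?_
    simpa using (h.mul_left 1 b a).1 hb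
  cover a := by
    rcases h.total 1 a with h1 | h1 | h1
    · exact Or.inl h1
    · exact Or.inr (Or.inl (Subgroup.mem_bot.2 h1.symm))
    · exact Or.inr (Or.inr (by simpa [positiveCone] using (h.mul_left a 1 a⁻¹).1 h1))
  disjoint_left a ha h1 := by
    obtain rfl := Subgroup.mem_bot.1 h1
    exact h.irrefl 1 ha
  disjoint_inv a ha ha' := by
    have : lt a 1 := by simpa using (h.mul_left 1 a⁻¹ a).1 ha'
    exact h.irrefl 1 (h.trans _ _ _ ha this)

theorem IsRelPositiveCone.isLeftOrder {P : Set G} (hP : IsRelPositiveCone ⊥ P) :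
    IsLeftOrder fun a b => a⁻¹ * b ∈ P where
  irrefl a h := hP.disjoint_left _ h (by simp)
  trans a b c hab hbc := by simpa [mul_assoc] using hP.mul_mem _ hab _ hbc
  total a b := by
    rcases hP.cover (a⁻¹ * b) with h | h | h
    · exact Or.inl h
    · exact Or.inr (Or.inl (inv_mul_eq_one.1 (Subgroup.mem_bot.1 h)))
    · exact Or.inr (Or.inr (by simpa using h))
  mul_left a b c := by simp [mul_assoc]

theorem positiveCone_inv_mul_mem (P : Set G) : positiveCone (fun a b => a⁻¹ * b ∈ P) = P := by
  simp [positiveCone]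

theorem IsLeftOrderOfClass.hasRegularCone {p : X → G} {lt : G → G → Prop}
    (h : IsLeftOrderOfClass Language.IsRegular p lt) : HasRegularCone ⊥ p :=
  let ⟨hlt, L, hL, hLlt⟩ := h
  ⟨L, hL, hLlt ▸ hlt.isRelPositiveCone⟩

theorem exists_isOneCounter_image_eval_eq [Finite X] {S Z : Type*} [Finite S]
    (T : Transducer S X Bool) (p : X → G) {r : Z → G} (hr : IsGenerating r) :
    ∃ L : Language Z, IsOneCounter L ∧
      eval r '' {w | w ∈ L} = eval p '' {w | w ∈ T.preimage posWords} := by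
  choose h hh using fun x => hr (p x)
  refine ⟨_, isOneCounter_image_flatMap_preimage_posWords T h, ?_⟩
  ext g
  constructor
  · rintro ⟨_, ⟨w, hw, rfl⟩, rfl⟩
    exact ⟨w, hw, (eval_flatMap p r hh w).symm⟩
  · rintro ⟨w, hw, rfl⟩
    exact ⟨_, ⟨w, hw, rfl⟩, eval_flatMap p r hh w⟩

end LeftOrder

/-! ### Free products -/

section Coprod

universe u v

/-- The family indexed by `Bool` that consists of `A` and `B`, lifted to a common universe; it
makes the free product of two groups an instance of the amalgamated free product of a family. -/
abbrev boolFamily (A : Type u) (B : Type v) : Bool → Type (max u v)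
  | true => ULift A
  | false => ULift B

instance {A : Type u} {B : Type v} [Group A] [Group B] : ∀ b, Group (boolFamily A B b)
  | true => inferInstanceAs (Group (ULift A))
  | false => inferInstanceAs (Group (ULift B))

instance {X : Type u} {Y : Type v} [Finite X] [Finite Y] : ∀ b, Finite (boolFamily X Y b)
  | true => inferInstanceAs (Finite (ULift X))
  | false => inferInstanceAs (Finite (ULift Y))

/-- The evaluations of letters for `boolFamily`. -/
def boolGens {A : Type u} {B : Type v} {X Y : Type*} (p : X → A) (q : Y → B) :
    ∀ b, boolFamily X Y b → boolFamily A B b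
  | true => fun x => ULift.up (p x.down)
  | false => fun y => ULift.up (q y.down)

/-- The letters of `X ⊔ Y` as letters of an amalgamated free product over the trivial group. -/
def boolLetter {X : Type u} {Y : Type v} : X ⊕ Y → Empty ⊕ Σ b, boolFamily X Y b :=
  Sum.elim (fun x => Sum.inr ⟨true, ULift.up x⟩) (fun y => Sum.inr ⟨false, ULift.up y⟩)

theorem boolLetter_surjective {X : Type u} {Y : Type v} :
    Function.Surjective (boolLetter : X ⊕ Y → _) := by
  rintro (y | ⟨_ | _, x⟩)
  · exact y.elim
  · exact ⟨Sum.inr x.down, rfl⟩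
  · exact ⟨Sum.inl x.down, rfl⟩

variable {A : Type u} {B : Type v} [Group A] [Group B]

/-- The free product of `A` and `B` as an amalgamated free product over the trivial group. -/
def coprodToPushout :
    Monoid.Coprod A B →* Monoid.PushoutI fun b => (1 : PUnit.{1} →* boolFamily A B b) :=
  Monoid.Coprod.lift
    ((Monoid.PushoutI.of (G := boolFamily A B) true).comp MulEquiv.ulift.symm.toMonoidHom)
    ((Monoid.PushoutI.of (G := boolFamily A B) false).comp MulEquiv.ulift.symm.toMonoidHom)

theorem coprodToPushout_coprodGens {X Y : Type*} (p : X → A) (q : Y → B) (x : X ⊕ Y) :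
    coprodToPushout (coprodGens p q x) =
      amalgamGens (fun b => (1 : PUnit.{1} →* boolFamily A B b)) (boolGens p q) Empty.elim
        (boolLetter x) := by
  cases x <;> rfl

theorem coprodToPushout_injective :
    Function.Injective (coprodToPushout : Monoid.Coprod A B →* _) := by
  let back : Monoid.PushoutI (fun b => (1 : PUnit.{1} →* boolFamily A B b)) →* Monoid.Coprod A B :=
    Monoid.PushoutI.lift
      (fun
        | true => Monoid.Coprod.inl.comp MulEquiv.ulift.toMonoidHom
        | false => Monoid.Coprod.inr.comp MulEquiv.ulift.toMonoidHom)
      1 (fun b => by ext; simp)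
  have hback : back.comp coprodToPushout = MonoidHom.id _ := by
    ext <;> simp [back, coprodToPushout]
  exact Function.LeftInverse.injective (DFunLike.congr_fun hback)

variable {X Y : Type*} [Finite X] [Finite Y] {p : X → A} {q : Y → B}

theorem exists_isTauTransducer_coprod (hp : IsGenerating p) (hq : IsGenerating q)
    (hpA : HasRegularCone ⊥ p) (hqB : HasRegularCone ⊥ q) :
    ∃ τ : Monoid.Coprod A B → ℤ, IsOrderingQuasimorphism τ ⊥ ∧ (∀ g, Odd (τ g) ∨ τ g = 0) ∧
      ∃ (S : Type) (_ : Finite S) (T : Transducer S (X ⊕ Y) Bool),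
        IsTauTransducer T (coprodGens p q) τ := by
  let φ : ∀ b, PUnit.{1} →* boolFamily A B b := fun _ => 1
  have hφ : ∀ b, Function.Injective (φ b) := fun _ => Function.injective_of_subsingleton _
  have hgen : ∀ b, IsGenerating (boolGens p q b)
    | true => hp.ulift
    | false => hq.ulift
  have hcone : ∀ b, HasRegularCone (φ b).range (boolGens p q b)
    | true => MonoidHom.range_one (G := PUnit.{1}) (N := ULift A) ▸ hpA.ulift
    | false => MonoidHom.range_one (G := PUnit.{1}) (N := ULift B) ▸ hqB.ulift
  choose L hL hP using hcone
  choose Lm hLm hLmP using fun b => exists_isRegular_image_eval_eq_inv (hgen b) (hL b)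
  obtain ⟨S, hS, T, hT, -⟩ := exists_isTauTransducer_amalgamQuasi (q := Empty.elim) hφ
    (fun _ => ⟨[], rfl⟩) hP hL (fun _ => rfl) hLm hLmP
  have hker : (Monoid.PushoutI.base φ).range.comap (coprodToPushout (A := A) (B := B)) = ⊥ := by
    have hbase : Monoid.PushoutI.base φ = 1 := MonoidHom.ext fun _ => map_one _
    rw [hbase, MonoidHom.range_one]
    exact (MonoidHom.ker_eq_bot_iff _).2 coprodToPushout_injective
  exact ⟨_, hker ▸ (isOrderingQuasimorphism_amalgamQuasi hP hφ).comp _,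
    fun g => odd_or_amalgamQuasi_eq_zero hP hφ _, S, hS, _,
    hT.comap (coprodToPushout_coprodGens p q) coprodToPushout_injective boolLetter_surjective⟩

end Coprod

end LeftOrderLang

theorem mainTheorem9_general :
    (∀ {ι H Y : Type*} {G X : ι → Type*} [Finite ι] [Group H]
      [∀ i, Group (G i)] [∀ i, Finite (X i)]
      (φ : ∀ i, H →* G i) (_ : ∀ i, Function.Injective (φ i))
      (p : ∀ i, X i → G i) (_ : ∀ i, IsGenerating (p i))
      (q : Y → H) (_ : IsGenerating q)
      (P : ∀ i, Set (G i)) (_ : ∀ i, IsRelPositiveCone (φ i).range (P i))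
      (L : ∀ i, Language (X i)) (_ : ∀ i, (L i).IsRegular)
      (_ : ∀ i, eval (p i) '' {w | w ∈ L i} = P i),
      ∃ τ : Monoid.PushoutI φ → ℤ,
        IsOrderingQuasimorphism τ (Monoid.PushoutI.base φ).range ∧
        (∀ g, Odd (τ g) ∨ τ g = 0) ∧
        ∃ Lm : ∀ i, Language (X i),
          (∀ i, (Lm i).IsRegular ∧ eval (p i) '' {w | w ∈ Lm i} = {g | g⁻¹ ∈ P i}) ∧
          ∃ (S : Type) (_ : Finite S) (T : Transducer S (Y ⊕ (Σ i, X i)) Bool),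
            IsTauTransducer T (amalgamGens φ p q) τ ∧
            IsRelPositiveCone (Monoid.PushoutI.base φ).range
              (eval (amalgamGens φ p q) '' {w | w ∈ T.preimage posWords}) ∧
            ∀ w, w ∈ T.preimage posWords ↔
              w ∈ syllableWords L Lm ∧ 0 < τ (eval (amalgamGens φ p q) w)) ∧
    (∀ {A B X Y : Type*} [Group A] [Group B] [Finite X] [Finite Y]
      (p : X → A) (_ : IsGenerating p) (q : Y → B) (_ : IsGenerating q)
      (ltA : A → A → Prop) (_ : IsLeftOrderOfClass Language.IsRegular p ltA)
      (ltB : B → B → Prop) (_ : IsLeftOrderOfClass Language.IsRegular q ltB),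
      ∃ τ : Monoid.Coprod A B → ℤ,
        IsOrderingQuasimorphism τ ⊥ ∧ (∀ g, Odd (τ g) ∨ τ g = 0) ∧
        (∃ (S : Type) (_ : Finite S) (T : Transducer S (X ⊕ Y) Bool),
          IsTauTransducer T (coprodGens p q) τ ∧
          IsOneCounter (T.preimage posWords) ∧
          eval (coprodGens p q) '' {w | w ∈ T.preimage posWords} = {g | 0 < τ g}) ∧
        ∃ lt : Monoid.Coprod A B → Monoid.Coprod A B → Prop,
          IsLeftOrder lt ∧ positiveCone lt = {g | 0 < τ g} ∧
          ∀ {Z : Type*} (r : Z → Monoid.Coprod A B), IsGenerating r →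
            IsLeftOrderOfClass IsOneCounter r lt) := by
  constructor
  · intro ι H Y G X _ _ _ _ φ hφ p hp q hq P hP L hL hLP
    classical
    let : LinearOrder ι := linearOrderOfSTO WellOrderingRel
    choose Lm hLm hLmP using fun i => exists_isRegular_image_eval_eq_inv (hp i) (hL i)
    simp only [hLP] at hLmP
    have hτ := isOrderingQuasimorphism_amalgamQuasi hP hφ
    obtain ⟨S, hS, T, hT, hdom⟩ :=
      exists_isTauTransducer_amalgamQuasi hφ hq hP hL hLP hLm hLmP
    refine ⟨amalgamQuasi φ P, hτ, odd_or_amalgamQuasi_eq_zero hP hφ, Lm,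
      fun i => ⟨hLm i, hLmP i⟩, S, hS, T, hT, ?_, fun w => ?_⟩
    · exact hT.image_eval_preimage_posWords ▸ hτ.isRelPositiveCone
    · rw [hT.mem_preimage_posWords_iff, hdom]
  · intro A B X Y _ _ _ _ p hp q hq ltA hA ltB hB
    obtain ⟨τ, hτ, hodd, S, hS, T, hT⟩ :=
      exists_isTauTransducer_coprod hp hq hA.hasRegularCone hB.hasRegularCone
    have himage := hT.image_eval_preimage_posWords
    have hlt := hτ.isRelPositiveCone.isLeftOrder
    have hpos := positiveCone_inv_mul_mem {g | 0 < τ g}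
    refine ⟨τ, hτ, hodd, ⟨S, hS, T, hT, isOneCounter_preimage_posWords T, himage⟩, _, hlt, hpos,
      fun r hr => ⟨hlt, ?_⟩⟩
    rw [hpos, ← himage]
    exact exists_isOneCounter_image_eval_eq T _ hr

theorem mainTheorem9 :
    -- amalgamated free products of finitely many groups
    (∀ {ι H Y : Type*} {G X : ι → Type*} [Finite ι] [Group H] [Finite Y]
      [∀ i, Group (G i)] [∀ i, Finite (X i)]
      (φ : ∀ i, H →* G i) (_ : ∀ i, Function.Injective (φ i))
      (p : ∀ i, X i → G i) (_ : ∀ i, IsGenerating (p i))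
      (q : Y → H) (_ : IsGenerating q)
      (P : ∀ i, Set (G i)) (_ : ∀ i, IsRelPositiveCone (φ i).range (P i))
      (L : ∀ i, Language (X i)) (_ : ∀ i, (L i).IsRegular)
      (_ : ∀ i, eval (p i) '' {w | w ∈ L i} = P i),
      ∃ τ : Monoid.PushoutI φ → ℤ,
        IsOrderingQuasimorphism τ (Monoid.PushoutI.base φ).range ∧
        (∀ g, Odd (τ g) ∨ τ g = 0) ∧
        ∃ Lm : ∀ i, Language (X i),
          (∀ i, (Lm i).IsRegular ∧ eval (p i) '' {w | w ∈ Lm i} = {g | g⁻¹ ∈ P i}) ∧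
          ∃ (S : Type) (_ : Finite S) (T : Transducer S (Y ⊕ (Σ i, X i)) Bool),
            IsTauTransducer T (amalgamGens φ p q) τ ∧
            IsRelPositiveCone (Monoid.PushoutI.base φ).range
              (eval (amalgamGens φ p q) '' {w | w ∈ T.preimage posWords}) ∧
            ∀ w, w ∈ T.preimage posWords ↔
              w ∈ syllableWords L Lm ∧ 0 < τ (eval (amalgamGens φ p q) w)) ∧
    -- free products of two groups
    (∀ {A B X Y : Type*} [Group A] [Group B] [Finite X] [Finite Y]
      (p : X → A) (_ : IsGenerating p) (q : Y → B) (_ : IsGenerating q)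
      (ltA : A → A → Prop) (_ : IsLeftOrderOfClass Language.IsRegular p ltA)
      (ltB : B → B → Prop) (_ : IsLeftOrderOfClass Language.IsRegular q ltB),
      ∃ τ : Monoid.Coprod A B → ℤ,
        IsOrderingQuasimorphism τ ⊥ ∧ (∀ g, Odd (τ g) ∨ τ g = 0) ∧
        (∃ (S : Type) (_ : Finite S) (T : Transducer S (X ⊕ Y) Bool),
          IsTauTransducer T (coprodGens p q) τ ∧
          IsOneCounter (T.preimage posWords) ∧
          eval (coprodGens p q) '' {w | w ∈ T.preimage posWords} = {g | 0 < τ g}) ∧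
        ∃ lt : Monoid.Coprod A B → Monoid.Coprod A B → Prop,
          IsLeftOrder lt ∧ positiveCone lt = {g | 0 < τ g} ∧
          ∀ {Z : Type*} [Finite Z] (r : Z → Monoid.Coprod A B), IsGenerating r →
            IsLeftOrderOfClass IsOneCounter r lt) :=
  mainTheorem9_general.imp (fun h => h) fun h => fun p hp q hq ltA hA ltB hB =>
    let ⟨τ, hτ, hodd, hT, lt, hlt, hpos, hr⟩ := h p hp q hq ltA hA ltB hB
    ⟨τ, hτ, hodd, hT, lt, hlt, hpos, fun r => hr r⟩
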